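/- For $\nu,\mu\in\mathbb C$ and $z\in\mathbb C\setminus(-\infty,1]$ let $$P_\nu^\mu(z)=\Bigl(\frac{z+1}{z-1}\Bigr)^{\mu/2}\,\mathbf F\Bigl(-\nu,\nu+1;1-\mu;\frac{1-z}{2}\Bigr)$$ be the associated Legendre function of the first kind, where the power has its principal value and $\mathbf F(a,b;c;x)$ is the regularized Gauss hypergeometric function, i.e. the analytic continuation to $\mathbb C\setminus[1,\infty)$ of $\sum_{j\ge0}\frac{(a)_j(b)_j}{\Gamma(c+j)\,j!}x^j$, $|x|<1$. Let $\psi=\Gamma'/\Gamma$, and let $(z^2-1)^{\alpha}$ stand for $(z-1)^\alpha(z+1)^\alpha$ with principal values. Let $z\in\mathbb C\setminus(-\infty,1]$. (a) Let $n\in\mathbb N_0$ and let $\mu\in\mathbb C$ be such that $\mu-n+\frac12\notin\{0,-1,-2,\dots\}$. Then $\nu\mapsto P_{\nu-1/2}^{\mu}(z)$ and $\nu\mapsto P_{\nu-1/2}^{-\mu}(z)$ are complex differentiable at $\nu=\pm n$, and $$\pm\Bigl[\frac{\partial}{\partial\nu}P_{\nu-1/2}^{\mu}(z)\Bigr]_{\nu=\pm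 n}=\Bigl[\psi\bigl(\mu+n+\tfrac12\bigr)-\psi\bigl(\mu-n+\tfrac12\bigr)\Bigr]P_{n-1/2}^{\mu}(z)+n!\,\Gamma\bigl(\mu-n+\tfrac12\bigr)\sum_{k=0}^{n-1}\frac{(z^2-1)^{(n-k)/2}}{\Gamma\bigl(\mu+n-2k+\frac12\bigr)\,k!\,(n-k)\,2^{k-n+1}}P_{k-1/2}^{\mu+n-k}(z),$$ $$\pm\Bigl[\frac{\partial}{\partial\nu}P_{\nu-1/2}^{-\mu}(z)\Bigr]_{\nu=\pm n}=\Bigl[\psi\bigl(\mu-n+\tfrac12\bigr)-\psi\bigl(\mu+n+\tfrac12\bigr)\Bigr]P_{n-1/2}^{-\mu}(z)+\frac{n!}{\Gamma\bigl(\mu+n+\frac12\bigr)}\sum_{k=0}^{n-1}\frac{\Gamma\bigl(\mu-n+2k+\frac12\bigr)(z^2-1)^{(n-k)/2}}{k!\,(n-k)\,2^{k-n+1}}P_{k-1/2}^{-\mu+n-k}(z),$$ and moreover $$\psi\bigl(\mu+n+\tfrac12\bigr)-\psi\bigl(\mu-n+\tfrac12\bigr)=2\mu\sum_{l=1}^{n}\Bigl[\mu^2-\bigl(l-\tfrac12\bigr)^2\Bigr]^{-1}.$$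 (b) For every $\mu\in\mathbb C$, $\bigl[\frac{\partial}{\partial\nu}P_{\nu-1/2}^{\mu}(z)\bigr]_{\nu=0}=0$. (c) For every $\mu\in\mathbb C$, the derivatives at $\nu=\pm1$ exist and $$\pm\bigl(\mu^2-\tfrac14\bigr)\Bigl[\frac{\partial}{\partial\nu}P_{\nu-1/2}^{\mu}(z)\Bigr]_{\nu=\pm1}=2\mu\,P_{1/2}^{\mu}(z)+(z^2-1)^{1/2}P_{-1/2}^{\mu+1}(z).$$ -/

import Mathlib

open Classical in
/-- Gauss' regularized hypergeometric function `F(a,b;c;x) / Γ(c)` on the cut plane `ℂ \ [1,∞)`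
(that is, where `1 - x ∈ Complex.slitPlane`): the analytic continuation of the sum
`∑ (a)_j (b)_j / (Γ(c + j) j!) x ^ j` from the unit disc. The cut plane is connected, so the values
there do not depend on the chosen `f`. -/
noncomputable def gaussF (a b c : ℂ) : ℂ → ℂ :=
  if h : ∃ f : ℂ → ℂ, DifferentiableOn ℂ f {x | 1 - x ∈ Complex.slitPlane} ∧
      ∀ x ∈ Metric.ball (0 : ℂ) 1, f x = Complex.regularizedGaussHGFun a b c x
  then h.choose else fun _ => 0

/-- The associated Legendre function of the first kind `P_ν^μ(z)` of degree `ν` and order `μ`,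
on the plane cut along `(-∞, 1]`:
`P_ν^μ(z) = ((z + 1) / (z - 1)) ^ (μ / 2) * F(-ν, ν + 1; 1 - μ; (1 - z) / 2) / Γ(1 - μ)`. -/
noncomputable def legendreP (ν μ z : ℂ) : ℂ :=
  ((z + 1) / (z - 1)) ^ (μ / 2) * gaussF (-ν) (ν + 1) (1 - μ) ((1 - z) / 2)

/-- The power `(z² - 1) ^ α` with the branch customary for Legendre functions, holomorphic on
`ℂ \ (-∞, 1]` and positive for `z > 1` and real `α`: `(z - 1) ^ α * (z + 1) ^ α` with principal
values. -/
noncomputable def sqSubOnePow (z α : ℂ) : ℂ := (z - 1) ^ α * (z + 1) ^ α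

/-- The value claimed for `± [∂/∂ν P_{ν-1/2}^μ(z)]_{ν = ± n}`. -/
noncomputable def degreeDerivP (n : ℕ) (μ z : ℂ) : ℂ :=
  (Complex.digamma (μ + n + 1 / 2) - Complex.digamma (μ - n + 1 / 2))
      * legendreP (n - 1 / 2) μ z
    + n.factorial * Complex.Gamma (μ - n + 1 / 2) *
      ∑ k ∈ Finset.range n,
        sqSubOnePow z (((n : ℂ) - k) / 2)
          / (Complex.Gamma (μ + n - 2 * k + 1 / 2) * k.factorial * ((n : ℂ) - k)
              * (2 : ℂ) ^ ((k : ℤ) - n + 1))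
          * legendreP (k - 1 / 2) (μ + n - k) z

/-- The value claimed for `± [∂/∂ν P_{ν-1/2}^{-μ}(z)]_{ν = ± n}`. -/
noncomputable def degreeDerivPNeg (n : ℕ) (μ z : ℂ) : ℂ :=
  (Complex.digamma (μ - n + 1 / 2) - Complex.digamma (μ + n + 1 / 2))
      * legendreP (n - 1 / 2) (-μ) z
    + n.factorial / Complex.Gamma (μ + n + 1 / 2) *
      ∑ k ∈ Finset.range n,
        Complex.Gamma (μ - n + 2 * k + 1 / 2) * sqSubOnePow z (((n : ℂ) - k) / 2)
          / (k.factorial * ((n : ℂ) - k) * (2 : ℂ) ^ ((k : ℤ) - n + 1))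
          * legendreP (k - 1 / 2) (-μ + n - k) z

/-! The engine is one contiguous relation. Put T_m(ν) = (z² - 1)^(m/2) P_{ν-1/2}^{μ+m}(z), which is
`scaledP`. It is even in ν and satisfies ((μ+m-ν)² - 1/4) T_m(ν+1) = ((μ+m+ν)² - 1/4) T_m(ν-1) + 2ν
T_{m+1}(ν) (`scaledP_recurrence`). Dividing by Γ(μ+m+1/2-ν) Γ(μ+m+1/2+ν), or for order -μ
multiplying by Γ(μ-m+1/2-ν) Γ(μ-m+1/2+ν), absorbs the quadratic factors and leaves the Bessel-type
recurrence A_m(ν+1) = A_m(ν-1) + 2ν A_{m+1}(ν).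

Evenness gives A_m'(0) = 0. Differentiating the recurrence at 0 gives A_m'(1) = A_{m+1}(0), and at
n+1 it expresses A_m'(n+2) through A_m'(n) and A_{m+1}'(n+1). Hence A_m'(n) is an explicit finite
sum (`hasDerivAt_of_recurrence`). Undoing the Gamma normalization by the product rule produces the
digamma difference. The case ν = ±1 for all μ comes from differentiating the unnormalized recurrence
at 0.

The analytic burden is to have F(1/2-ν, 1/2+ν; c; x) on the whole cut plane, holomorphic in x and in
ν. Euler's integral gives this for Re c large, a contiguous relation in c lowers c, and the identity
theorem carries disc identities to the cut plane. -/

/-! ### Power series and contiguous relations in the unit disc -/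

/-- The `j`-th coefficient of the regularized Gauss hypergeometric series. -/
noncomputable def gaussCoeff (a b c : ℂ) (j : ℕ) : ℂ :=
  (ascPochhammer ℂ j).eval a * (ascPochhammer ℂ j).eval b
    * ((j.factorial : ℂ)⁻¹ * (Complex.Gamma (c + j))⁻¹)

lemma hasSum_gaussCoeff (a b c : ℂ) {x : ℂ} (hx : ‖x‖ < 1) :
    HasSum (fun j => gaussCoeff a b c j * x ^ j) (Complex.regularizedGaussHGFun a b c x) := by
  have h := (Complex.regularizedGaussHGFunSeries a b c).hasSum (x := x) (by
    rw [Metric.mem_eball, edist_zero_right]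
    refine lt_of_lt_of_le ?_ (Complex.radius_regularizedGaussHGFunSeries_ge_one a b c)
    rwa [← ofReal_norm, ENNReal.ofReal_lt_one])
  have e : (fun j => gaussCoeff a b c j * x ^ j) = fun j =>
      (Complex.regularizedGaussHGFunSeries a b c j) fun _ => x := by
    funext j
    rw [FormalMultilinearSeries.apply_eq_pow_smul_coeff,
      Complex.coeff_regularizedGaussHGFunSeries, gaussCoeff, smul_eq_mul, div_eq_mul_inv,
      mul_inv, mul_comm]
  rw [e]
  exact h

/-- The coefficients of a power series multiplied by its variable. -/
def shiftSeq (s : ℕ → ℂ) : ℕ → ℂ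
  | 0 => 0
  | j + 1 => s j

lemma HasSum.shift_mul {s : ℕ → ℂ} {x S : ℂ} (h : HasSum (fun j => s j * x ^ j) S) :
    HasSum (fun j => shiftSeq s j * x ^ j) (x * S) := by
  rw [← hasSum_nat_add_iff' 1]
  have e : (fun j => shiftSeq s (j + 1) * x ^ (j + 1)) = fun j => x * (s j * x ^ j) := by
    funext j
    rw [shiftSeq]
    ring
  rw [e]
  simpa [shiftSeq] using h.mul_left x

/-- Written for 1/Γ, the functional equation also holds at the poles of Γ; this is why the
contiguous relations below need no restriction on c. -/
lemma inv_Gamma_eq (s : ℂ) : (Complex.Gamma s)⁻¹ = s * (Complex.Gamma (s + 1))⁻¹ :=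
  Complex.one_div_Gamma_eq_self_mul_one_div_Gamma_add_one s

lemma ascPochhammer_eval_succ_left (a : ℂ) (j : ℕ) :
    (ascPochhammer ℂ (j + 1)).eval a = a * (ascPochhammer ℂ j).eval (a + 1) := by
  simp [ascPochhammer_succ_left]

lemma inv_factorial_eq (j : ℕ) :
    ((j.factorial : ℂ))⁻¹ = (j + 1) * (((j + 1).factorial : ℕ) : ℂ)⁻¹ := by
  have : (j.factorial : ℂ) ≠ 0 := by exact_mod_cast j.factorial_ne_zero
  have h' : (j : ℂ) + 1 ≠ 0 := by exact_mod_cast j.succ_ne_zero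
  rw [Nat.factorial_succ]
  push_cast
  field_simp

/-- The contiguous relation between the lower parameters `c - 1`, `c`, `c + 1`, in the disc. -/
lemma regularizedGaussHGFun_contiguous_lower (a b c : ℂ) {x : ℂ} (hx : ‖x‖ < 1) :
    (1 - x) * Complex.regularizedGaussHGFun a b (c - 1) x =
      (c - 1 - (2 * c - a - b - 1) * x) * Complex.regularizedGaussHGFun a b c x
        + (c - a) * (c - b) * x * Complex.regularizedGaussHGFun a b (c + 1) x := by
  have h0 := hasSum_gaussCoeff a b (c - 1) hx
  have h1 := hasSum_gaussCoeff a b c hx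
  have h2 := hasSum_gaussCoeff a b (c + 1) hx
  have hl := h0.sub h0.shift_mul
  have hr := ((h1.mul_left (c - 1)).sub (h1.shift_mul.mul_left (2 * c - a - b - 1))).add
    (h2.shift_mul.mul_left ((c - a) * (c - b)))
  rw [show (fun j => gaussCoeff a b (c - 1) j * x ^ j - shiftSeq (gaussCoeff a b (c - 1)) j * x ^ j)
      = fun j => (c - 1) * (gaussCoeff a b c j * x ^ j)
        - (2 * c - a - b - 1) * (shiftSeq (gaussCoeff a b c) j * x ^ j)
        + (c - a) * (c - b) * (shiftSeq (gaussCoeff a b (c + 1)) j * x ^ j) from ?_] at hl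
  · linear_combination hl.unique hr
  -- Both sides are power series in x, so it suffices to compare coefficients; each 1/Γ is expressed
  -- through the one of largest argument.
  funext j
  cases j with
  | zero =>
    have e := inv_Gamma_eq (c - 1)
    rw [sub_add_cancel] at e
    simp only [gaussCoeff, shiftSeq, Nat.cast_zero, add_zero, e]
    ring
  | succ j =>
    have e1 : (Complex.Gamma (c - 1 + (j : ℂ)))⁻¹ = (c - 1 + j) * (Complex.Gamma (c + j))⁻¹ := by
      rw [inv_Gamma_eq]; ring_nf
    have e2 : (Complex.Gamma (c + (j : ℂ)))⁻¹ = (c + j) * (Complex.Gamma (c + (j + 1)))⁻¹ := by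
      rw [inv_Gamma_eq]; ring_nf
    have e3 : c - 1 + ((j : ℂ) + 1) = c + j := by ring
    have e4 : c + 1 + (j : ℂ) = c + (j + 1) := by ring
    simp only [gaussCoeff, shiftSeq, ascPochhammer_succ_eval, inv_factorial_eq j, Nat.cast_add,
      Nat.cast_one, e1, e3, e4, e2]
    ring

/-- The contiguous relation between the degrees `ν - 1`, `ν`, `ν + 1`, in the disc. -/
lemma regularizedGaussHGFun_contiguous_degree (ν c : ℂ) {x : ℂ} (hx : ‖x‖ < 1) :
    (c + ν - 1 / 2) * (c + ν - 3 / 2)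
        * Complex.regularizedGaussHGFun (1 / 2 - (ν + 1)) (1 / 2 + (ν + 1)) c x =
      (c - ν - 1 / 2) * (c - ν - 3 / 2)
        * Complex.regularizedGaussHGFun (1 / 2 - (ν - 1)) (1 / 2 + (ν - 1)) c x
      + 4 * ν * (1 - x) * Complex.regularizedGaussHGFun (1 / 2 - ν) (1 / 2 + ν) (c - 1) x := by
  have h0 := hasSum_gaussCoeff (1 / 2 - (ν + 1)) (1 / 2 + (ν + 1)) c hx
  have h1 := hasSum_gaussCoeff (1 / 2 - (ν - 1)) (1 / 2 + (ν - 1)) c hx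
  have h2 := hasSum_gaussCoeff (1 / 2 - ν) (1 / 2 + ν) (c - 1) hx
  have hl := h0.mul_left ((c + ν - 1 / 2) * (c + ν - 3 / 2))
  have hr := (h1.mul_left ((c - ν - 1 / 2) * (c - ν - 3 / 2))).add
    ((h2.sub h2.shift_mul).mul_left (4 * ν))
  rw [show (fun j => (c + ν - 1 / 2) * (c + ν - 3 / 2)
        * (gaussCoeff (1 / 2 - (ν + 1)) (1 / 2 + (ν + 1)) c j * x ^ j))
      = fun j => (c - ν - 1 / 2) * (c - ν - 3 / 2)
          * (gaussCoeff (1 / 2 - (ν - 1)) (1 / 2 + (ν - 1)) c j * x ^ j)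
        + 4 * ν * (gaussCoeff (1 / 2 - ν) (1 / 2 + ν) (c - 1) j * x ^ j
          - shiftSeq (gaussCoeff (1 / 2 - ν) (1 / 2 + ν) (c - 1)) j * x ^ j) from ?_] at hl
  · linear_combination hl.unique hr
  funext j
  -- The general case splits two factors off the Pochhammer symbols of length j + 2, so the indices
  -- 0 and 1 are separate.
  match j with
  | 0 =>
    have e := inv_Gamma_eq (c - 1)
    rw [sub_add_cancel] at e
    simp only [gaussCoeff, shiftSeq, Nat.cast_zero, add_zero, e]
    simp
    ring
  | 1 =>
    have e := inv_Gamma_eq (c - 1)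
    rw [sub_add_cancel, inv_Gamma_eq c] at e
    have e3 : c - 1 + (1 : ℂ) = c := by ring
    simp only [gaussCoeff, shiftSeq, Nat.cast_zero, Nat.cast_one, add_zero, e3, e]
    simp [inv_Gamma_eq c]
    ring
  | j + 2 =>
    have e1 : (Complex.Gamma (c - 1 + ((j : ℂ) + 1)))⁻¹
        = (c + j) * (Complex.Gamma (c + (j + 1)))⁻¹ := by
      rw [inv_Gamma_eq]; ring_nf
    have e2 : (Complex.Gamma (c + ((j : ℂ) + 1)))⁻¹
        = (c + j + 1) * (Complex.Gamma (c + (j + 1 + 1)))⁻¹ := by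
      rw [inv_Gamma_eq]; ring_nf
    have e3 : c - 1 + ((j : ℂ) + 1 + 1) = c + (j + 1) := by ring
    -- All Pochhammer symbols are reduced to those of 3/2 - ν and 3/2 + ν of the common length j;
    -- what remains is a polynomial identity.
    have s1 : (1 : ℂ) / 2 - (ν + 1) + 1 + 1 = 3 / 2 - ν := by ring
    have s2 : (1 : ℂ) / 2 + (ν - 1) + 1 + 1 = 3 / 2 + ν := by ring
    have s3 : (1 : ℂ) / 2 - (ν - 1) = 3 / 2 - ν := by ring
    have s4 : (1 : ℂ) / 2 + (ν + 1) = 3 / 2 + ν := by ring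
    have s5 : (1 : ℂ) / 2 - ν + 1 = 3 / 2 - ν := by ring
    have s6 : (1 : ℂ) / 2 + ν + 1 = 3 / 2 + ν := by ring
    have a1 : (ascPochhammer ℂ (j + 1 + 1)).eval (1 / 2 - (ν + 1)) = (1 / 2 - (ν + 1))
        * ((1 / 2 - ν) * (ascPochhammer ℂ j).eval (3 / 2 - ν)) := by
      rw [ascPochhammer_eval_succ_left, ascPochhammer_eval_succ_left, s1]; ring
    have a2 : (ascPochhammer ℂ (j + 1 + 1)).eval (1 / 2 + (ν - 1)) = (1 / 2 + (ν - 1))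
        * ((1 / 2 + ν) * (ascPochhammer ℂ j).eval (3 / 2 + ν)) := by
      rw [ascPochhammer_eval_succ_left, ascPochhammer_eval_succ_left, s2]; ring
    have a3 : (ascPochhammer ℂ (j + 1)).eval (1 / 2 - ν) = (1 / 2 - ν)
        * (ascPochhammer ℂ j).eval (3 / 2 - ν) := by
      rw [ascPochhammer_eval_succ_left, s5]
    have a4 : (ascPochhammer ℂ (j + 1)).eval (1 / 2 + ν) = (1 / 2 + ν)
        * (ascPochhammer ℂ j).eval (3 / 2 + ν) := by
      rw [ascPochhammer_eval_succ_left, s6]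
    have a5 : (ascPochhammer ℂ (j + 1 + 1)).eval (1 / 2 - ν) = (1 / 2 - ν)
        * (ascPochhammer ℂ j).eval (3 / 2 - ν) * (3 / 2 - ν + j) := by
      rw [ascPochhammer_succ_eval, a3]; push_cast; ring
    have a6 : (ascPochhammer ℂ (j + 1 + 1)).eval (1 / 2 + ν) = (1 / 2 + ν)
        * (ascPochhammer ℂ j).eval (3 / 2 + ν) * (3 / 2 + ν + j) := by
      rw [ascPochhammer_succ_eval, a4]; push_cast; ring
    have a7 (s : ℂ) : (ascPochhammer ℂ (j + 1 + 1)).eval s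
        = (ascPochhammer ℂ j).eval s * (s + j) * (s + j + 1) := by
      rw [ascPochhammer_succ_eval, ascPochhammer_succ_eval]; push_cast; ring
    rw [show j + 2 = j + 1 + 1 from rfl]
    simp only [gaussCoeff, shiftSeq, a1, a2, s3, s4, a3, a4, a5, a6]
    rw [a7 (3 / 2 - ν), a7 (3 / 2 + ν), inv_factorial_eq (j + 1)]
    simp only [Nat.cast_add, Nat.cast_one, e1, e3, e2]
    ring

/-! ### Euler's integral and its holomorphy -/

open MeasureTheory in
/-- An integral depending holomorphically on a parameter, with a locally uniform integrable bound,
is holomorphic. -/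
lemma differentiableAt_integral_of_dominated {α : Type*} [MeasurableSpace α] {m : Measure α}
    {f : ℂ → α → ℂ} {bound : α → ℝ} {s₀ : ℂ} {r : ℝ} (hr : 0 < r)
    (hmeas : ∀ s ∈ Metric.ball s₀ r, AEStronglyMeasurable (f s) m)
    (hd : ∀ᵐ t ∂m, DifferentiableOn ℂ (fun s => f s t) (Metric.ball s₀ r))
    (hb : Integrable bound m) (hle : ∀ᵐ t ∂m, ∀ s ∈ Metric.ball s₀ r, ‖f s t‖ ≤ bound t) :
    DifferentiableAt ℂ (fun s => ∫ t, f s t ∂m) s₀ := by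
  have hs₀ : s₀ ∈ Metric.ball s₀ r := Metric.mem_ball_self hr
  have hder : ∀ᵐ t ∂m, ∀ s ∈ Metric.ball s₀ (r / 2),
      HasDerivAt (fun s => f s t) (deriv (fun s => f s t) s) s := by
    filter_upwards [hd] with t ht s hs
    exact (ht.differentiableAt (Metric.isOpen_ball.mem_nhds
      (Metric.ball_subset_ball (by linarith) hs))).hasDerivAt
  refine (hasDerivAt_integral_of_dominated_loc_of_deriv_le (s := Metric.ball s₀ (r / 2))
    (bound := fun t => bound t / (r / 4)) (F' := fun s t => deriv (fun s => f s t) s)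
    (Metric.ball_mem_nhds _ (by positivity)) ?_ ?_ ?_ ?_ (hb.div_const _)
    hder).2.differentiableAt
  · filter_upwards [Metric.ball_mem_nhds s₀ hr] with s hs using hmeas s hs
  · exact hb.mono' (hmeas s₀ hs₀) (hle.mono fun t ht => ht s₀ hs₀)
  -- Measurability of the derivative in t: it is a pointwise limit of difference quotients along s₀
  -- + r/(k+2).
  · have hseq : Filter.Tendsto (fun k : ℕ => s₀ + ((r / (k + 2) : ℝ) : ℂ)) Filter.atTop
        (nhdsWithin s₀ {s₀}ᶜ) := by
      refine tendsto_nhdsWithin_iff.2 ⟨?_, Filter.Eventually.of_forall fun k => ?_⟩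
      · have h1 : Filter.Tendsto (fun k : ℕ => r / ((k : ℝ) + 2)) Filter.atTop (nhds 0) :=
          tendsto_const_nhds.div_atTop
            (Filter.tendsto_atTop_add_const_right _ _ tendsto_natCast_atTop_atTop)
        have h2 := (Complex.continuous_ofReal.tendsto 0).comp h1
        simpa using h2.const_add s₀
      · have : (r / ((k : ℝ) + 2)) ≠ 0 := by positivity
        simpa only [Set.mem_compl_iff, Set.mem_singleton_iff, add_eq_left, Complex.ofReal_eq_zero]
          using this
    refine aestronglyMeasurable_of_tendsto_ae Filter.atTop
      (f := fun (k : ℕ) t => slope (fun s => f s t) s₀ (s₀ + ((r / (k + 2) : ℝ) : ℂ))) ?_ ?_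
    · intro k
      have hk : s₀ + ((r / (k + 2) : ℝ) : ℂ) ∈ Metric.ball s₀ r := by
        rw [Metric.mem_ball, dist_self_add_left, Complex.norm_real, Real.norm_of_nonneg
          (by positivity)]
        exact div_lt_self hr (by linarith [(Nat.cast_nonneg k : (0 : ℝ) ≤ k)])
      simp only [slope_def_field]
      simp only [div_eq_mul_inv]
      exact ((hmeas _ hk).sub (hmeas _ hs₀)).mul_const _
    · filter_upwards [hder] with t ht
      exact (hasDerivAt_iff_tendsto_slope.1
        (ht s₀ (Metric.mem_ball_self (by positivity)))).comp hseq
  · filter_upwards [hd, hle] with t ht hlt s hs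
    -- Cauchy's estimate on circles of radius r/4 turns the bound on f into one on its derivative.
    have hsub : Metric.closedBall s (r / 4) ⊆ Metric.ball s₀ r := by
      refine Metric.closedBall_subset_ball' ?_
      rw [Metric.mem_ball] at hs
      linarith
    exact Complex.norm_deriv_le_of_forall_mem_sphere_norm_le (by positivity)
      ((ht.mono hsub).diffContOnCl_ball subset_rfl)
      fun w hw => hlt w (hsub (Metric.sphere_subset_closedBall hw))

/-- The integrand of Euler's integral for `F(1/2 - ν, 1/2 + ν; c; x)`. -/
noncomputable def eulerKernel (c ν x : ℂ) (t : ℝ) : ℂ :=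
  (t : ℂ) ^ (ν - 1 / 2) * (1 - (t : ℂ)) ^ (c - ν - 3 / 2) * (1 - x * t) ^ (ν - 1 / 2)

lemma isOpen_cutPlane : IsOpen {x : ℂ | 1 - x ∈ Complex.slitPlane} :=
  Complex.isOpen_slitPlane.preimage (by fun_prop)

lemma one_sub_mul_mem_slitPlane {x : ℂ} (hx : 1 - x ∈ Complex.slitPlane) {t : ℝ}
    (ht : t ∈ Set.Icc (0 : ℝ) 1) : 1 - x * t ∈ Complex.slitPlane := by
  have := Complex.starConvex_one_slitPlane hx (sub_nonneg.2 ht.2) ht.1 (by ring)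
  convert this using 1
  simp only [Complex.real_smul]
  push_cast
  ring

lemma isPreconnected_cutPlane : IsPreconnected {x : ℂ | 1 - x ∈ Complex.slitPlane} := by
  have h : StarConvex ℝ (0 : ℂ) {x : ℂ | 1 - x ∈ Complex.slitPlane} := by
    rw [starConvex_zero_iff]
    intro x hx t h0 h1
    have := one_sub_mul_mem_slitPlane hx ⟨h0, h1⟩
    rwa [Set.mem_ofPred_eq, Complex.real_smul, mul_comm]
  exact (h.isPathConnected (by simp)).isConnected.isPreconnected

lemma one_sub_ofReal_ne_zero {t : ℝ} (ht : t ∈ Set.Ioo (0 : ℝ) 1) : (1 : ℂ) - t ≠ 0 := by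
  have : (1 - t : ℝ) ≠ 0 := (sub_pos.2 ht.2).ne'
  exact_mod_cast this

lemma eulerKernel_aestronglyMeasurable (c ν : ℂ) {x : ℂ} (hx : 1 - x ∈ Complex.slitPlane) :
    MeasureTheory.AEStronglyMeasurable (eulerKernel c ν x)
      (MeasureTheory.volume.restrict (Set.Ioo 0 1)) := by
  refine ContinuousOn.aestronglyMeasurable (fun t ht => ContinuousAt.continuousWithinAt ?_)
    measurableSet_Ioo
  have h1 : (t : ℂ) ∈ Complex.slitPlane := Complex.ofReal_mem_slitPlane.2 ht.1
  have h2 : (1 : ℂ) - t ∈ Complex.slitPlane := by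
    have := Complex.ofReal_mem_slitPlane.2 (sub_pos.2 ht.2)
    exact_mod_cast this
  have h3 := one_sub_mul_mem_slitPlane hx (Set.Ioo_subset_Icc_self ht)
  unfold eulerKernel
  exact (((Complex.continuous_ofReal.continuousAt).cpow continuousAt_const h1).mul
    (ContinuousAt.cpow (by fun_prop) continuousAt_const h2)).mul
    (ContinuousAt.cpow (by fun_prop) continuousAt_const h3)

/-- A locally uniform integrable bound for the integrand of Euler's integral. -/
lemma exists_eulerKernel_bound {c ν₀ x₀ : ℂ} (hν : -1 / 2 < ν₀.re) (hc : ν₀.re + 3 / 2 < c.re)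
    (hx : 1 - x₀ ∈ Complex.slitPlane) :
    ∃ r > 0, ∃ bound : ℝ → ℝ,
      MeasureTheory.Integrable bound (MeasureTheory.volume.restrict (Set.Ioo 0 1)) ∧
      ∀ ν ∈ Metric.ball ν₀ r, ∀ x ∈ Metric.ball x₀ r, 1 - x ∈ Complex.slitPlane ∧
        ∀ t ∈ Set.Ioo (0 : ℝ) 1, ‖eulerKernel c ν x t‖ ≤ bound t := by
  obtain ⟨r₁, hr₁, hb₁⟩ := Metric.nhds_basis_closedBall.mem_iff.1 (isOpen_cutPlane.mem_nhds hx)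
  -- Half the distance of Re ν₀ to -1/2: for |ν - ν₀| < δ the exponent Re ν - 1/2 stays above δ - 1
  -- > -1, so t^(δ-1) is an integrable majorant at 0. The other constraint on r keeps the exponent
  -- of 1 - t nonnegative.
  set δ := (ν₀.re + 1 / 2) / 2 with hδ
  have hδ0 : 0 < δ := by rw [hδ]; linarith
  set r := min r₁ (min δ (c.re - ν₀.re - 3 / 2)) with hr
  have hr0 : 0 < r := lt_min hr₁ (lt_min hδ0 (by linarith))
  have hrδ : r ≤ δ := (min_le_right _ _).trans (min_le_left _ _)
  have hrc : r ≤ c.re - ν₀.re - 3 / 2 := (min_le_right _ _).trans (min_le_right _ _)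
  have hcont : ContinuousOn (fun p : ℂ × ℂ × ℝ => (1 - p.2.1 * p.2.2) ^ (p.1 - 1 / 2))
      (Metric.closedBall ν₀ r ×ˢ Metric.closedBall x₀ r₁ ×ˢ Set.Icc (0 : ℝ) 1) := by
    rintro ⟨ν, x, t⟩ ⟨-, hx', ht⟩
    refine ContinuousAt.continuousWithinAt ?_
    exact ContinuousAt.cpow (by fun_prop) (by fun_prop) (one_sub_mul_mem_slitPlane (hb₁ hx') ht)
  obtain ⟨C, hC⟩ := ((isCompact_closedBall ν₀ r).prod
    ((isCompact_closedBall x₀ r₁).prod isCompact_Icc)).exists_bound_of_continuousOn hcont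
  refine ⟨r, hr0, fun t => t ^ (δ - 1) * C, ?_, fun ν hν' x hx' => ⟨?_, fun t ht => ?_⟩⟩
  · refine MeasureTheory.Integrable.mul_const ?_ C
    have := (intervalIntegral.intervalIntegrable_rpow' (a := 0) (b := 1)
      (show -1 < δ - 1 by linarith))
    rw [intervalIntegrable_iff_integrableOn_Ioo_of_le zero_le_one] at this
    exact this
  · exact hb₁ (Metric.ball_subset_closedBall (Metric.ball_subset_ball (min_le_left _ _) hx'))
  · have hre : |ν.re - ν₀.re| < r := by
      rw [Metric.mem_ball, Complex.dist_eq] at hν'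
      rw [← Complex.sub_re]
      exact (Complex.abs_re_le_norm (ν - ν₀)).trans_lt hν'
    rw [abs_lt] at hre
    have h1 : ‖(t : ℂ) ^ (ν - 1 / 2)‖ ≤ t ^ (δ - 1) := by
      rw [Complex.norm_cpow_eq_rpow_re_of_pos ht.1]
      refine Real.rpow_le_rpow_of_exponent_ge ht.1 ht.2.le ?_
      norm_num
      linarith
    have h2 : ‖(1 - (t : ℂ)) ^ (c - ν - 3 / 2)‖ ≤ 1 := by
      have : (1 : ℂ) - t = ((1 - t : ℝ) : ℂ) := by push_cast; rfl
      rw [this, Complex.norm_cpow_eq_rpow_re_of_pos (sub_pos.2 ht.2)]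
      refine Real.rpow_le_one (sub_pos.2 ht.2).le (by linarith [ht.1]) ?_
      norm_num
      linarith
    have h3 : ‖(1 - x * t) ^ (ν - 1 / 2)‖ ≤ C :=
      hC (ν, x, t) ⟨Metric.ball_subset_closedBall hν', Metric.ball_subset_closedBall
        (Metric.ball_subset_ball (min_le_left _ _) hx'), Set.Ioo_subset_Icc_self ht⟩
    rw [eulerKernel, norm_mul, norm_mul]
    have h4 : 0 ≤ t ^ (δ - 1) := Real.rpow_nonneg ht.1.le _
    calc _ ≤ t ^ (δ - 1) * 1 * C := by gcongr
      _ = _ := by ring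

/-- Euler's integral for the regularized hypergeometric function `F(1/2 - ν, 1/2 + ν; c; x)`. -/
noncomputable def eulerF (c ν x : ℂ) : ℂ :=
  (Complex.Gamma (1 / 2 + ν))⁻¹ * (Complex.Gamma (c - (1 / 2 + ν)))⁻¹
    * ∫ t in Set.Ioo (0 : ℝ) 1, eulerKernel c ν x t

lemma eulerF_differentiableAt_argument {c ν x : ℂ} (hν : -1 / 2 < ν.re)
    (hc : ν.re + 3 / 2 < c.re) (hx : 1 - x ∈ Complex.slitPlane) :
    DifferentiableAt ℂ (eulerF c ν) x := by
  obtain ⟨r, hr, bound, hb, h⟩ := exists_eulerKernel_bound hν hc hx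
  have hν' := Metric.mem_ball_self (x := ν) hr
  refine DifferentiableAt.const_mul (differentiableAt_integral_of_dominated hr (bound := bound)
    (fun y hy => eulerKernel_aestronglyMeasurable c ν (h ν hν' y hy).1) ?_ hb ?_) _
  · filter_upwards [MeasureTheory.ae_restrict_mem measurableSet_Ioo] with t ht y hy
    refine DifferentiableAt.differentiableWithinAt ?_
    unfold eulerKernel
    refine DifferentiableAt.const_mul (DifferentiableAt.cpow_const (by fun_prop) ?_) _
    exact one_sub_mul_mem_slitPlane (h ν hν' y hy).1 (Set.Ioo_subset_Icc_self ht)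
  · filter_upwards [MeasureTheory.ae_restrict_mem measurableSet_Ioo] with t ht y hy
    exact (h ν hν' y hy).2 t ht

lemma eulerF_differentiableAt_degree {c ν x : ℂ} (hν : -1 / 2 < ν.re)
    (hc : ν.re + 3 / 2 < c.re) (hx : 1 - x ∈ Complex.slitPlane) :
    DifferentiableAt ℂ (fun ν => eulerF c ν x) ν := by
  obtain ⟨r, hr, bound, hb, h⟩ := exists_eulerKernel_bound hν hc hx
  have hx' := Metric.mem_ball_self (x := x) hr
  unfold eulerF
  refine DifferentiableAt.mul (DifferentiableAt.mul ?_ ?_)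
    (differentiableAt_integral_of_dominated hr (bound := bound)
    (fun y hy => eulerKernel_aestronglyMeasurable c y hx) ?_ hb ?_)
  · exact Complex.differentiable_one_div_Gamma.differentiableAt.comp ν (by fun_prop)
  · exact Complex.differentiable_one_div_Gamma.differentiableAt.comp ν (by fun_prop)
  · filter_upwards [MeasureTheory.ae_restrict_mem measurableSet_Ioo] with t ht y hy
    refine DifferentiableAt.differentiableWithinAt ?_
    have h1 : (t : ℂ) ≠ 0 := by exact_mod_cast ht.1.ne'
    have h2 := one_sub_ofReal_ne_zero ht
    have h3 := Complex.slitPlane_ne_zero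
      (one_sub_mul_mem_slitPlane hx (Set.Ioo_subset_Icc_self ht))
    unfold eulerKernel
    exact ((DifferentiableAt.const_cpow (by fun_prop) (Or.inl h1)).mul
      (DifferentiableAt.const_cpow (by fun_prop) (Or.inl h2))).mul
      (DifferentiableAt.const_cpow (by fun_prop) (Or.inl h3))
  · filter_upwards [MeasureTheory.ae_restrict_mem measurableSet_Ioo] with t ht y hy
    exact (h y hy x hx').2 t ht

lemma hasSum_one_sub_cpow_neg (a : ℂ) {x : ℂ} (hx : ‖x‖ < 1) :
    HasSum (fun j : ℕ => (ascPochhammer ℂ j).eval a * (j.factorial : ℂ)⁻¹ * x ^ j)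
      ((1 - x) ^ (-a)) := by
  have h := (Complex.one_div_one_sub_cpow_hasFPowerSeriesOnBall_zero a).hasSum (y := x) (by
    rwa [Metric.mem_eball, edist_zero_right, ← ofReal_norm, ENNReal.ofReal_lt_one])
  rw [zero_add, one_div, ← Complex.cpow_neg] at h
  refine (congrArg (fun f => HasSum f _) (funext fun j => ?_)).mpr h
  have hj : (j.factorial : ℂ) ≠ 0 := by exact_mod_cast j.factorial_ne_zero
  have e : (j.factorial : ℂ) * Ring.multichoose a j = (ascPochhammer ℂ j).eval a := by
    rw [← Polynomial.ascPochhammer_smeval_eq_eval,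
      ← Ring.factorial_nsmul_multichoose_eq_ascPochhammer, nsmul_eq_mul]
  have e' : Ring.choose (a + j - 1) j = Ring.multichoose a j := by
    rw [Ring.choose]; congr 1; ring
  rw [FormalMultilinearSeries.apply_eq_pow_smul_coeff, FormalMultilinearSeries.coeff_ofScalars,
    e', ← e, smul_eq_mul]
  field_simp

/-- Inside the unit disc Euler's integral is the hypergeometric series. -/
lemma eulerF_eq_regularizedGaussHGFun {c ν x : ℂ} (hν : -1 / 2 < ν.re)
    (hc : ν.re + 3 / 2 < c.re) (hx : ‖x‖ < 1) :
    eulerF c ν x = Complex.regularizedGaussHGFun (1 / 2 - ν) (1 / 2 + ν) c x := by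
  have hb : 0 < (1 / 2 + ν).re := by norm_num; linarith
  have hcb : 0 < (c - (1 / 2 + ν)).re := by norm_num; linarith
  set k : ℝ → ℂ := fun t => (t : ℂ) ^ (ν - 1 / 2) * (1 - (t : ℂ)) ^ (c - ν - 3 / 2) with hk
  have hkint : MeasureTheory.Integrable k (MeasureTheory.volume.restrict (Set.Ioo 0 1)) := by
    have := Complex.betaIntegral_convergent hb hcb
    rw [intervalIntegrable_iff_integrableOn_Ioo_of_le zero_le_one] at this
    rw [show 1 / 2 + ν - 1 = ν - 1 / 2 by ring,
      show c - (1 / 2 + ν) - 1 = c - ν - 3 / 2 by ring] at this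
    exact this
  have hs := hasSum_one_sub_cpow_neg (1 / 2 - ν) hx
  set p : ℕ → ℂ := fun j => (ascPochhammer ℂ j).eval (1 / 2 - ν) * (j.factorial : ℂ)⁻¹ with hp
  -- The factor (1 - xt)^(ν-1/2) is expanded by the binomial series and integrated termwise, with
  -- majorants ‖k t‖ ‖p j x^j‖ because 0 < t < 1.
  have hsum := MeasureTheory.hasSum_integral_of_dominated_convergence
    (μ := MeasureTheory.volume.restrict (Set.Ioo (0 : ℝ) 1))
    (F := fun j t => k t * (p j * (x * t) ^ j)) (f := eulerKernel c ν x)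
    (fun j t => ‖k t‖ * ‖p j * x ^ j‖) ?_ ?_ ?_ ?_ ?_
  -- Each term is a beta integral B(1/2 + ν + j, c - 1/2 - ν), and Γ(b + j) = Γ(b) (b)_j turns it
  -- into the hypergeometric coefficient.
  · have hint (j : ℕ) : ∫ t in Set.Ioo (0 : ℝ) 1, k t * (p j * (x * t) ^ j) =
        Complex.Gamma (1 / 2 + ν) * Complex.Gamma (c - (1 / 2 + ν))
          * (gaussCoeff (1 / 2 - ν) (1 / 2 + ν) c j * x ^ j) := by
      have hbj : 0 < (1 / 2 + ν + j).re := by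
        rw [Complex.add_re, Complex.natCast_re]; positivity
      have hB := Complex.Gamma_mul_Gamma_eq_betaIntegral hbj hcb
      have hG : Complex.Gamma (1 / 2 + ν + j) =
          Complex.Gamma (1 / 2 + ν) * (ascPochhammer ℂ j).eval (1 / 2 + ν) := by
        rw [← Complex.Gamma_add_nat_div_Gamma_eq _ fun n hn => ?_,
          mul_div_cancel₀ _ (Complex.Gamma_ne_zero_of_re_pos hb)]
        rw [hn] at hb
        simp only [Complex.neg_re, Complex.natCast_re] at hb
        linarith [(Nat.cast_nonneg n : (0 : ℝ) ≤ n)]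
      have hne : Complex.Gamma (c + j) ≠ 0 := by
        refine Complex.Gamma_ne_zero_of_re_pos ?_
        rw [Complex.add_re, Complex.natCast_re]
        have : 0 < c.re := by linarith
        positivity
      rw [show 1 / 2 + ν + j + (c - (1 / 2 + ν)) = c + j by ring, hG] at hB
      have hI : ∫ t in Set.Ioo (0 : ℝ) 1, k t * (p j * (x * t) ^ j) =
          p j * x ^ j * Complex.betaIntegral (1 / 2 + ν + j) (c - (1 / 2 + ν)) := by
        rw [Complex.betaIntegral, intervalIntegral.integral_of_le zero_le_one,
          MeasureTheory.integral_Ioc_eq_integral_Ioo, ← MeasureTheory.integral_const_mul]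
        refine MeasureTheory.setIntegral_congr_fun measurableSet_Ioo fun t ht => ?_
        have ht0 : (t : ℂ) ≠ 0 := by exact_mod_cast ht.1.ne'
        simp only [hk]
        rw [show 1 / 2 + ν + (j : ℂ) - 1 = ν - 1 / 2 + j by ring, Complex.cpow_add _ _ ht0,
          Complex.cpow_natCast, show c - (1 / 2 + ν) - 1 = c - ν - 3 / 2 by ring]
        ring
      rw [hI, gaussCoeff, hp]
      have hB' : Complex.betaIntegral (1 / 2 + ν + j) (c - (1 / 2 + ν)) =
          Complex.Gamma (1 / 2 + ν) * (ascPochhammer ℂ j).eval (1 / 2 + ν)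
            * Complex.Gamma (c - (1 / 2 + ν)) * (Complex.Gamma (c + j))⁻¹ := by
        rw [hB]; field_simp
      rw [hB']
      ring
    simp only [hint] at hsum
    have := hsum.unique ((hasSum_gaussCoeff (1 / 2 - ν) (1 / 2 + ν) c hx).mul_left
      (Complex.Gamma (1 / 2 + ν) * Complex.Gamma (c - (1 / 2 + ν))))
    have h1 := Complex.Gamma_ne_zero_of_re_pos hb
    have h2 := Complex.Gamma_ne_zero_of_re_pos hcb
    rw [eulerF, this, mul_assoc (Complex.Gamma _) (Complex.Gamma _), mul_assoc (_)⁻¹,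
      mul_left_comm (_)⁻¹ (Complex.Gamma _), inv_mul_cancel_left₀ h1, inv_mul_cancel_left₀ h2]
  · intro j
    exact hkint.aestronglyMeasurable.mul (Continuous.aestronglyMeasurable (by fun_prop))
  · intro j
    filter_upwards [MeasureTheory.ae_restrict_mem measurableSet_Ioo] with t ht
    rw [norm_mul (k t), norm_mul (p j), norm_mul (p j), norm_pow, norm_pow, norm_mul x]
    gcongr
    rw [Complex.norm_real, Real.norm_of_nonneg ht.1.le]
    exact mul_le_of_le_one_right (norm_nonneg _) ht.2.le
  · exact Filter.Eventually.of_forall fun t => (hs.summable.norm).mul_left _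
  · simp only [tsum_mul_left]
    exact hkint.norm.mul_const _
  · filter_upwards [MeasureTheory.ae_restrict_mem measurableSet_Ioo] with t ht
    have hxt : ‖x * t‖ < 1 := by
      rw [norm_mul, Complex.norm_real, Real.norm_of_nonneg ht.1.le]
      exact (mul_le_of_le_one_right (norm_nonneg _) ht.2.le).trans_lt hx
    have := (hasSum_one_sub_cpow_neg (1 / 2 - ν) hxt).mul_left (k t)
    rwa [neg_sub] at this

/-! ### Continuation to the cut plane -/

lemma ball_subset_cutPlane :
    Metric.ball (0 : ℂ) 1 ⊆ {x : ℂ | 1 - x ∈ Complex.slitPlane} := by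
  intro x hx
  rw [mem_ball_zero_iff] at hx
  have := Complex.mem_slitPlane_of_norm_lt_one (z := -x) (by rwa [norm_neg])
  rwa [← sub_eq_add_neg] at this

/-- Holomorphic functions on the cut plane that agree on the unit disc agree. -/
lemma eqOn_cutPlane {f g : ℂ → ℂ} (hf : DifferentiableOn ℂ f {x | 1 - x ∈ Complex.slitPlane})
    (hg : DifferentiableOn ℂ g {x | 1 - x ∈ Complex.slitPlane})
    (h : ∀ x ∈ Metric.ball (0 : ℂ) 1, f x = g x) :
    Set.EqOn f g {x | 1 - x ∈ Complex.slitPlane} :=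
  (hf.analyticOnNhd isOpen_cutPlane).eqOn_of_preconnected_of_eventuallyEq
    (hg.analyticOnNhd isOpen_cutPlane) isPreconnected_cutPlane (z₀ := 0) (by simp)
    (Filter.eventually_of_mem (Metric.ball_mem_nhds 0 one_pos) h)

/-- A holomorphic continuation of the hypergeometric series `F(1/2 - ν, 1/2 + ν; c; x)` to the
cut plane that depends holomorphically on `ν`. -/
lemma exists_continuation (M : ℝ) (c : ℂ) : ∃ Φ : ℂ → ℂ → ℂ, ∀ ν : ℂ, -1 / 2 < ν.re → ν.re < M →
    (∀ x, 1 - x ∈ Complex.slitPlane →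
      DifferentiableAt ℂ (Φ ν) x ∧ DifferentiableAt ℂ (fun ν => Φ ν x) ν) ∧
    ∀ x, ‖x‖ < 1 → Φ ν x = Complex.regularizedGaussHGFun (1 / 2 - ν) (1 / 2 + ν) c x := by
  -- k counts the unit shifts that lift Re c above M + 3/2, where Euler's integral serves every ν
  -- with -1/2 < Re ν < M.
  obtain ⟨k, hk⟩ := exists_nat_gt (M + 3 / 2 - c.re)
  induction k generalizing c with
  | zero =>
    rw [Nat.cast_zero] at hk
    refine ⟨eulerF c, fun ν h1 h2 => ⟨fun x hx => ⟨?_, ?_⟩, fun x hx => ?_⟩⟩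
    · exact eulerF_differentiableAt_argument h1 (by linarith) hx
    · exact eulerF_differentiableAt_degree h1 (by linarith) hx
    · exact eulerF_eq_regularizedGaussHGFun h1 (by linarith) hx
  | succ k ih =>
    push_cast at hk
    obtain ⟨Φ, hΦ⟩ := ih (c + 1) (by rw [Complex.add_re, Complex.one_re]; linarith)
    obtain ⟨Ψ, hΨ⟩ := ih (c + 1 + 1) (by simp only [Complex.add_re, Complex.one_re]; linarith)
    -- The contiguous relation at c + 1, solved for the function with parameter c; 1 - x has no zero
    -- on the cut plane.
    refine ⟨fun ν x => ((c - 2 * c * x) * Φ ν x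
      + (c + 1 / 2 + ν) * (c + 1 / 2 - ν) * x * Ψ ν x) / (1 - x), fun ν h1 h2 =>
      ⟨fun x hx => ?_, fun x hx => ?_⟩⟩
    · obtain ⟨d1, d2⟩ := (hΦ ν h1 h2).1 x hx
      obtain ⟨e1, e2⟩ := (hΨ ν h1 h2).1 x hx
      have hne := Complex.slitPlane_ne_zero hx
      exact ⟨by fun_prop (disch := assumption), by fun_prop (disch := assumption)⟩
    · have hne := Complex.slitPlane_ne_zero (ball_subset_cutPlane (mem_ball_zero_iff.2 hx))
      have := regularizedGaussHGFun_contiguous_lower (1 / 2 - ν) (1 / 2 + ν) (c + 1) hx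
      rw [add_sub_cancel_right] at this
      simp only [(hΦ ν h1 h2).2 x hx, (hΨ ν h1 h2).2 x hx]
      rw [div_eq_iff hne, mul_comm _ (1 - x), this]
      ring

/-- The hypergeometric function of Legendre type, `F(1/2 - ν, 1/2 + ν; c; x)`. -/
noncomputable def legendreF (ν c x : ℂ) : ℂ := gaussF (1 / 2 - ν) (1 / 2 + ν) c x

/-- The series is symmetric in its upper parameters, and `gaussF` depends on them only through the
series, so the choice made in its definition is the same for ν and -ν. -/
lemma legendreF_neg (ν c x : ℂ) : legendreF (-ν) c x = legendreF ν c x := by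
  unfold legendreF gaussF
  rw [sub_neg_eq_add, ← sub_eq_add_neg, Complex.regularizedGaussHGFun_symm]

lemma gaussF_spec {a b c : ℂ} {f : ℂ → ℂ}
    (hf : ∀ x, 1 - x ∈ Complex.slitPlane → DifferentiableAt ℂ f x)
    (h : ∀ x, ‖x‖ < 1 → f x = Complex.regularizedGaussHGFun a b c x) :
    DifferentiableOn ℂ (gaussF a b c) {x | 1 - x ∈ Complex.slitPlane} ∧
      ∀ x ∈ Metric.ball (0 : ℂ) 1, gaussF a b c x = Complex.regularizedGaussHGFun a b c x := by
  have hex : ∃ f : ℂ → ℂ, DifferentiableOn ℂ f {x | 1 - x ∈ Complex.slitPlane} ∧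
      ∀ x ∈ Metric.ball (0 : ℂ) 1, f x = Complex.regularizedGaussHGFun a b c x :=
    ⟨f, fun x hx => (hf x hx).differentiableWithinAt, fun x hx => h x (mem_ball_zero_iff.1 hx)⟩
  rw [gaussF, dif_pos hex]
  exact hex.choose_spec

lemma legendreF_spec (ν c : ℂ) :
    DifferentiableOn ℂ (legendreF ν c) {x | 1 - x ∈ Complex.slitPlane} ∧
      ∀ x ∈ Metric.ball (0 : ℂ) 1,
        legendreF ν c x = Complex.regularizedGaussHGFun (1 / 2 - ν) (1 / 2 + ν) c x := by
  -- Evenness in ν moves any ν into the half-plane where the continuation was built.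
  wlog hν : -1 / 2 < ν.re generalizing ν
  · have := this (-ν) (by rw [Complex.neg_re]; linarith)
    rw [show legendreF (-ν) c = legendreF ν c from funext (legendreF_neg ν c), sub_neg_eq_add,
      ← sub_eq_add_neg, Complex.regularizedGaussHGFun_symm] at this
    exact this
  obtain ⟨Φ, hΦ⟩ := exists_continuation (ν.re + 1) c
  obtain ⟨h1, h2⟩ := hΦ ν hν (by linarith)
  exact gaussF_spec (fun x hx => (h1 x hx).1) h2

/-- `gaussF` is chosen separately for each ν, so regularity in ν is not visible from its definition;
by the identity theorem it agrees with the family Φ, which is holomorphic in ν. -/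
lemma legendreF_differentiableAt_degree (ν c : ℂ) {x : ℂ} (hx : 1 - x ∈ Complex.slitPlane) :
    DifferentiableAt ℂ (fun ν => legendreF ν c x) ν := by
  wlog hν : -1 / 2 < ν.re generalizing ν
  · have := (this (-ν) (by rw [Complex.neg_re]; linarith)).comp ν differentiableAt_id.neg
    refine this.congr_of_eventuallyEq (Filter.Eventually.of_forall fun w => ?_)
    exact (legendreF_neg w c x).symm
  obtain ⟨Φ, hΦ⟩ := exists_continuation (ν.re + 1) c
  refine ((hΦ ν hν (by linarith)).1 x hx).2.congr_of_eventuallyEq ?_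
  filter_upwards [(isOpen_lt continuous_const Complex.continuous_re).mem_nhds hν,
    (isOpen_lt Complex.continuous_re continuous_const).mem_nhds
      (show ν.re < ν.re + 1 by linarith)] with w hw1 hw2
  obtain ⟨h1, h2⟩ := hΦ w hw1 hw2
  refine eqOn_cutPlane (legendreF_spec w c).1
    (fun y hy => (h1 y hy).1.differentiableWithinAt) (fun y hy => ?_) hx
  rw [(legendreF_spec w c).2 y hy, h2 y (mem_ball_zero_iff.1 hy)]

/-- The contiguous relation between the degrees `ν - 1`, `ν`, `ν + 1`, on the cut plane. -/
lemma legendreF_contiguous (ν c : ℂ) {x : ℂ} (hx : 1 - x ∈ Complex.slitPlane) :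
    (c + ν - 1 / 2) * (c + ν - 3 / 2) * legendreF (ν + 1) c x =
      (c - ν - 1 / 2) * (c - ν - 3 / 2) * legendreF (ν - 1) c x
      + 4 * ν * (1 - x) * legendreF ν (c - 1) x := by
  have d1 := (legendreF_spec (ν + 1) c).1
  have d2 := (legendreF_spec (ν - 1) c).1
  have d3 := (legendreF_spec ν (c - 1)).1
  refine eqOn_cutPlane (f := fun x => (c + ν - 1 / 2) * (c + ν - 3 / 2) * legendreF (ν + 1) c x)
    (g := fun x => (c - ν - 1 / 2) * (c - ν - 3 / 2) * legendreF (ν - 1) c x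
      + 4 * ν * (1 - x) * legendreF ν (c - 1) x) (by fun_prop) (by fun_prop) (fun y hy => ?_) hx
  simp only [(legendreF_spec (ν + 1) c).2 y hy, (legendreF_spec (ν - 1) c).2 y hy,
    (legendreF_spec ν (c - 1)).2 y hy]
  exact regularizedGaussHGFun_contiguous_degree ν c (mem_ball_zero_iff.1 hy)

/-! ### Derivatives of even solutions of the recurrence -/

/-- The coefficients of the finite sum that expresses the derivative with respect to the degree. -/
noncomputable def degreeWeight (n k : ℕ) : ℂ :=
  n.factorial * 2 ^ (n - k) / (2 * k.factorial * ((n : ℂ) - k))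

/-- The induction step of `hasDerivAt_of_recurrence` in combinatorial form, for H k = A (m + n + 2 -
k) k: the differentiated recurrence, with the sum for n rewritten in terms of H. -/
lemma sum_degreeWeight_add_two (n : ℕ) (H : ℕ → ℂ) :
    ∑ k ∈ Finset.range (n + 2), degreeWeight (n + 2) k * H k =
      ∑ k ∈ Finset.range n, degreeWeight n k * (H (k + 2) - 2 * (k + 1) * H (k + 1))
        + 2 * H (n + 1)
        + 2 * (n + 1) * ∑ k ∈ Finset.range (n + 1), degreeWeight (n + 1) k * H k := by
  have fne (j : ℕ) : (j.factorial : ℂ) ≠ 0 := by exact_mod_cast j.factorial_ne_zero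
  have cne (j : ℕ) : (j : ℂ) + 1 ≠ 0 := by exact_mod_cast j.succ_ne_zero
  -- α j and β j are the weights of n at j - 2 and j - 1 (the latter times 2j) after reindexing. The
  -- factors j(j - 1) and j vanish at the added indices, so the sums may start at 0.
  set α : ℕ → ℂ := fun j => j * (j - 1) * (n.factorial * 2 ^ (n + 2 - j)
    / (2 * j.factorial * ((n : ℂ) + 2 - j))) with hα
  set β : ℕ → ℂ := fun j => 2 * j * (j * (n.factorial * 2 ^ (n + 1 - j)
    / (2 * j.factorial * ((n : ℂ) + 1 - j)))) with hβ
  have h1 : ∑ k ∈ Finset.range n, degreeWeight n k * H (k + 2)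
      = ∑ j ∈ Finset.range (n + 2), α j * H j := by
    rw [Finset.sum_range_succ', Finset.sum_range_succ']
    have e0 : α 0 = 0 := by simp [hα]
    have e1 : α (0 + 1) = 0 := by simp [hα]
    rw [e0, e1, zero_mul, zero_mul, add_zero, add_zero]
    refine Finset.sum_congr rfl fun k hk => ?_
    obtain ⟨d, rfl⟩ := Nat.exists_eq_add_of_lt (Finset.mem_range.1 hk)
    congr 1
    simp only [hα, degreeWeight, Nat.factorial_succ k, Nat.factorial_succ (k + 1)]
    rw [show k + d + 1 + 2 - (k + 1 + 1) = k + d + 1 - k by omega]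
    have := cne d
    have := cne k
    have h2 : (k : ℂ) + 1 + 1 ≠ 0 := by exact_mod_cast (k + 1).succ_ne_zero
    have := fne k
    push_cast
    rw [show (k : ℂ) + d + 1 - k = d + 1 by ring,
      show (k : ℂ) + d + 1 + 2 - (k + 1 + 1) = d + 1 by ring]
    field_simp
    ring
  have h2 : ∑ k ∈ Finset.range n, degreeWeight n k * (2 * (k + 1) * H (k + 1))
      = ∑ j ∈ Finset.range (n + 1), β j * H j := by
    rw [Finset.sum_range_succ']
    have e0 : β 0 = 0 := by simp [hβ]
    rw [e0, zero_mul, add_zero]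
    refine Finset.sum_congr rfl fun k hk => ?_
    obtain ⟨d, rfl⟩ := Nat.exists_eq_add_of_lt (Finset.mem_range.1 hk)
    rw [← mul_assoc]
    congr 1
    simp only [hβ, degreeWeight, Nat.factorial_succ k]
    rw [show k + d + 1 + 1 - (k + 1) = k + d + 1 - k by omega]
    have := cne d
    have := cne k
    have := fne k
    push_cast
    rw [show (k : ℂ) + d + 1 - k = d + 1 by ring,
      show (k : ℂ) + d + 1 + 1 - (k + 1) = d + 1 by ring]
    field_simp
  have hw : degreeWeight (n + 2) (n + 1) = n + 2 := by
    rw [degreeWeight, show n + 2 - (n + 1) = 1 by omega, Nat.factorial_succ (n + 1)]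
    have := fne (n + 1)
    push_cast
    rw [show (n : ℂ) + 2 - (n + 1) = 1 by ring]
    field_simp
    ring
  have hαn : α (n + 1) = n := by
    simp only [hα]
    rw [show n + 2 - (n + 1) = 1 by omega, Nat.factorial_succ n]
    have := fne n
    have := cne n
    push_cast
    rw [show (n : ℂ) + 2 - (n + 1) = 1 by ring]
    field_simp
    ring
  have hj : ∀ j ∈ Finset.range (n + 1), degreeWeight (n + 2) j * H j
      = α j * H j - β j * H j + 2 * (n + 1) * (degreeWeight (n + 1) j * H j) := by
    intro j hj
    obtain ⟨d, rfl⟩ := Nat.exists_eq_add_of_le (Nat.lt_succ_iff.1 (Finset.mem_range.1 hj))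
    simp only [hα, hβ, degreeWeight, Nat.factorial_succ (j + d), Nat.factorial_succ (j + d + 1)]
    rw [show j + d + 2 - j = d + 2 by omega, show j + d + 1 - j = d + 1 by omega]
    have := fne j
    have := cne d
    have h2 : (d : ℂ) + 2 ≠ 0 := by exact_mod_cast (d + 1).succ_ne_zero
    push_cast
    rw [show (j : ℂ) + d + 2 - j = d + 2 by ring, show (j : ℂ) + d + 1 - j = d + 1 by ring]
    field_simp
    ring
  simp only [mul_sub, Finset.sum_sub_distrib]
  rw [h1, h2, Finset.sum_range_succ, Finset.sum_range_succ (fun j => α j * H j), hw, hαn,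
    Finset.sum_congr rfl hj, Finset.sum_add_distrib, Finset.sum_sub_distrib, Finset.mul_sum]
  ring

/-- The derivative of an even function is odd. -/
lemma HasDerivAt.of_even {f : ℂ → ℂ} (hf : ∀ w, f (-w) = f w) {d s : ℂ} (h : HasDerivAt f d s) :
    HasDerivAt f (-d) (-s) := by
  rw [← neg_neg s] at h
  have := h.comp (-s) (hasDerivAt_neg (-s))
  rw [mul_neg_one] at this
  exact this.congr_of_eventuallyEq (Filter.Eventually.of_forall fun w => (hf w).symm)

lemma HasDerivAt.eq_zero_of_even {f : ℂ → ℂ} (hf : ∀ w, f (-w) = f w) {d : ℂ}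
    (h : HasDerivAt f d 0) : d = 0 := by
  have := h.of_even hf
  rw [neg_zero] at this
  exact self_eq_neg.1 (h.unique this)

/-- The derivative at the natural numbers of a family of even functions that obey the three-term
recurrence of the modified Bessel functions. -/
lemma hasDerivAt_of_recurrence {A : ℕ → ℂ → ℂ} {N : ℕ} (heven : ∀ m ν, A m (-ν) = A m ν)
    (hdiff : ∀ n m : ℕ, n + m ≤ N → DifferentiableAt ℂ (A m) n)
    (hrec : ∀ n m : ℕ, n + m + 1 ≤ N →
      ∀ᶠ ν in nhds (n : ℂ), A m (ν + 1) = A m (ν - 1) + 2 * ν * A (m + 1) ν) (n : ℕ) :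
    ∀ m : ℕ, n + m ≤ N → HasDerivAt (A m)
      (∑ k ∈ Finset.range n, degreeWeight n k * A (m + n - k) k) n := by
  induction n using Nat.twoStepInduction with
  | zero =>
    intro m hm
    have h := (hdiff 0 m hm).hasDerivAt
    rw [Nat.cast_zero] at h ⊢
    rw [h.eq_zero_of_even (heven m)] at h
    simpa using h
  | one =>
    intro m hm
    have h := (hdiff 1 m hm).hasDerivAt
    rw [Nat.cast_one] at h ⊢
    have hA := (hdiff 0 (m + 1) (by omega)).hasDerivAt
    have hr := hrec 0 m (by omega)
    rw [Nat.cast_zero] at hA hr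
    have h1 : HasDerivAt (fun ν => A m (ν + 1)) (deriv (A m) 1) 0 :=
      HasDerivAt.comp_add_const 0 1 (by rwa [zero_add])
    have h2 : HasDerivAt (fun ν => A m (ν - 1)) (-deriv (A m) 1) 0 :=
      HasDerivAt.comp_sub_const 0 1 (by rw [zero_sub]; exact h.of_even (heven m))
    have h3 := h2.add (((hasDerivAt_id (0 : ℂ)).const_mul 2).mul hA)
    have e := (h1.congr_of_eventuallyEq (hr.mono fun _ hw => hw.symm)).unique h3
    have e' : deriv (A m) 1 = A (m + 1) 0 := by
      simp only [id, mul_one, mul_zero, zero_mul, add_zero] at e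
      linear_combination e / 2
    rw [e'] at h
    simpa [degreeWeight] using h
  | more n ih1 ih2 =>
    intro m hm
    have h := (hdiff (n + 2) m hm).hasDerivAt
    have hA := ih2 (m + 1) (by omega)
    have hB := ih1 m (by omega)
    have h1 : HasDerivAt (fun ν => A m (ν + 1)) (deriv (A m) ((n + 2 : ℕ) : ℂ)) ((n + 1 : ℕ) : ℂ) :=
      HasDerivAt.comp_add_const _ 1 (by
        convert h using 1
        push_cast
        ring)
    have h2 := HasDerivAt.comp_sub_const (f := A m) ((n + 1 : ℕ) : ℂ) 1 (by
      rw [Nat.cast_succ, add_sub_cancel_right]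
      exact hB)
    have h3 := h2.add (((hasDerivAt_id ((n + 1 : ℕ) : ℂ)).const_mul 2).mul hA)
    have e := (h1.congr_of_eventuallyEq ((hrec (n + 1) m (by omega)).mono
      fun _ hw => hw.symm)).unique h3
    rw [e] at h
    refine h.congr_deriv ?_
    rw [sum_degreeWeight_add_two n fun k => A (m + (n + 2) - k) k]
    -- The recurrence at ν = k + 1, read backwards, raises the order index so that every term has
    -- the form H k.
    have s1 : ∀ k ∈ Finset.range n, degreeWeight n k * (A (m + (n + 2) - (k + 2)) ((k + 2 : ℕ) : ℂ)
        - 2 * (k + 1) * A (m + (n + 2) - (k + 1)) ((k + 1 : ℕ) : ℂ))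
        = degreeWeight n k * A (m + n - k) k := by
      intro k hk
      have hk' := Finset.mem_range.1 hk
      have hr := (hrec (k + 1) (m + n - k) (by omega)).self_of_nhds
      rw [show m + (n + 2) - (k + 2) = m + n - k by omega,
        show m + (n + 2) - (k + 1) = m + n - k + 1 by omega]
      push_cast at hr ⊢
      rw [add_sub_cancel_right] at hr
      rw [show (k : ℂ) + 2 = k + 1 + 1 by ring, hr]
      ring
    rw [Finset.sum_congr rfl s1]
    have s2 : ∀ k ∈ Finset.range (n + 1), degreeWeight (n + 1) k * A (m + 1 + (n + 1) - k) k
        = degreeWeight (n + 1) k * A (m + (n + 2) - k) k := by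
      intro k _
      rw [show m + 1 + (n + 1) = m + (n + 2) by omega]
    rw [Finset.sum_congr rfl s2, show m + (n + 2) - (n + 1) = m + 1 by omega]
    simp only [id, mul_one]
    push_cast
    ring

/-! ### Branches of powers and the Legendre recurrence -/

/-- Off the real axis z + 1 and z - 1 lie in the same open half-plane, so their arguments have the
same sign; on the real axis z > 1 and both vanish. -/
lemma sub_arg_mem_Ioo {z : ℂ} (hz : z - 1 ∈ Complex.slitPlane) :
    (z + 1).arg - (z - 1).arg ∈ Set.Ioo (-Real.pi) Real.pi := by
  have hpi := Real.pi_pos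
  rcases lt_trichotomy z.im 0 with h | h | h
  · have h1 : (z + 1).arg < 0 := Complex.arg_neg_iff.2 (by simpa using h)
    have h2 : (z - 1).arg < 0 := Complex.arg_neg_iff.2 (by simpa using h)
    have h3 := Complex.neg_pi_lt_arg (z + 1)
    have h4 := Complex.neg_pi_lt_arg (z - 1)
    constructor <;> linarith
  · have h0 : 0 < (z - 1).re := by
      rcases Complex.mem_slitPlane_iff.1 hz with h' | h'
      · exact h'
      · simp [h] at h'
    have h1 : (z + 1).arg = 0 := Complex.arg_eq_zero_iff.2
      ⟨by simp at h0 ⊢; linarith, by simpa using h⟩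
    have h2 : (z - 1).arg = 0 := Complex.arg_eq_zero_iff.2 ⟨h0.le, by simpa using h⟩
    rw [h1, h2]
    constructor <;> linarith
  · have h1 : 0 < (z + 1).arg := by
      refine lt_of_le_of_ne (Complex.arg_nonneg_iff.2 (by simpa using h.le)) fun h' => ?_
      exact h.ne' (by simpa using (Complex.arg_eq_zero_iff.1 h'.symm).2)
    have h2 : 0 < (z - 1).arg := by
      refine lt_of_le_of_ne (Complex.arg_nonneg_iff.2 (by simpa using h.le)) fun h' => ?_
      exact h.ne' (by simpa using (Complex.arg_eq_zero_iff.1 h'.symm).2)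
    have h3 : (z + 1).arg < Real.pi := Complex.arg_lt_pi_iff.2 (Or.inr (by simpa using h.ne'))
    have h4 : (z - 1).arg < Real.pi := Complex.arg_lt_pi_iff.2 (Or.inr (by simpa using h.ne'))
    constructor <;> linarith

lemma add_one_mem_slitPlane {z : ℂ} (hz : z - 1 ∈ Complex.slitPlane) :
    z + 1 ∈ Complex.slitPlane := by
  rw [Complex.mem_slitPlane_iff] at hz ⊢
  simp only [Complex.sub_re, Complex.sub_im, Complex.add_re, Complex.add_im, Complex.one_re,
    Complex.one_im, sub_zero, add_zero] at hz ⊢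
  exact hz.imp (fun h => by linarith) id

lemma one_sub_half_mem_slitPlane {z : ℂ} (hz : z - 1 ∈ Complex.slitPlane) :
    1 - (1 - z) / 2 ∈ Complex.slitPlane := by
  have h := add_one_mem_slitPlane hz
  have e : 1 - (1 - z) / 2 = (z + 1) / 2 := by ring
  rw [e, Complex.mem_slitPlane_iff] at *
  simpa using h

/-- The logarithm of the quotient splits without a 2πi correction, so the powers of z - 1 cancel.
The scaling by (z² - 1)^(m/2) thus makes the prefactor independent of m up to (z + 1)^m. -/
lemma sqSubOnePow_mul_div_cpow {z : ℂ} (hz : z - 1 ∈ Complex.slitPlane) (μ : ℂ) (m : ℕ) :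
    sqSubOnePow z (m / 2) * ((z + 1) / (z - 1)) ^ ((μ + m) / 2)
      = ((z + 1) / (z - 1)) ^ (μ / 2) * (z + 1) ^ m := by
  have h1 := Complex.slitPlane_ne_zero (add_one_mem_slitPlane hz)
  have h2 := Complex.slitPlane_ne_zero hz
  have hlog : Complex.log ((z + 1) / (z - 1)) = Complex.log (z + 1) - Complex.log (z - 1) := by
    have harg := sub_arg_mem_Ioo hz
    have hpi := Complex.slitPlane_arg_ne_pi hz
    rw [div_eq_mul_inv, Complex.log_mul h1 (inv_ne_zero h2), Complex.log_inv _ hpi]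
    · ring
    · rw [Complex.arg_inv, if_neg hpi, ← sub_eq_add_neg]
      exact Set.Ioo_subset_Ioc_self harg
  rw [sqSubOnePow, Complex.cpow_def_of_ne_zero h1, Complex.cpow_def_of_ne_zero h2,
    Complex.cpow_def_of_ne_zero (div_ne_zero h1 h2), Complex.cpow_def_of_ne_zero
    (div_ne_zero h1 h2), ← Complex.exp_log h1, ← Complex.exp_nat_mul, ← Complex.exp_add,
    ← Complex.exp_add, ← Complex.exp_add, Complex.exp_log h1, hlog]
  congr 1
  ring

/-- The Legendre function of degree `ν - 1/2` and order `μ + m`, times `(z² - 1) ^ (m / 2)`. -/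
noncomputable def scaledP (z μ : ℂ) (m : ℕ) (ν : ℂ) : ℂ :=
  sqSubOnePow z (m / 2) * legendreP (ν - 1 / 2) (μ + m) z

lemma legendreP_eq (ν μ z : ℂ) : legendreP (ν - 1 / 2) μ z =
    ((z + 1) / (z - 1)) ^ (μ / 2) * legendreF ν (1 - μ) ((1 - z) / 2) := by
  rw [legendreP, legendreF, neg_sub, show ν - 1 / 2 + 1 = 1 / 2 + ν by ring]

lemma scaledP_zero (z μ ν : ℂ) : scaledP z μ 0 ν = legendreP (ν - 1 / 2) μ z := by
  simp [scaledP, sqSubOnePow]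

lemma scaledP_eq {z : ℂ} (hz : z - 1 ∈ Complex.slitPlane) (μ : ℂ) (m : ℕ) (ν : ℂ) :
    scaledP z μ m ν = ((z + 1) / (z - 1)) ^ (μ / 2)
      * ((z + 1) ^ m * legendreF ν (1 - μ - m) ((1 - z) / 2)) := by
  rw [scaledP, legendreP_eq, ← mul_assoc, sqSubOnePow_mul_div_cpow hz, sub_sub, mul_assoc]

lemma scaledP_neg (z μ : ℂ) (m : ℕ) (ν : ℂ) : scaledP z μ m (-ν) = scaledP z μ m ν := by
  simp only [scaledP, legendreP_eq, legendreF_neg]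

lemma scaledP_differentiable {z : ℂ} (hz : z - 1 ∈ Complex.slitPlane) (μ : ℂ) (m : ℕ) :
    Differentiable ℂ (scaledP z μ m) := by
  intro ν
  unfold scaledP
  simp only [legendreP_eq]
  exact ((legendreF_differentiableAt_degree ν _ (one_sub_half_mem_slitPlane hz)).const_mul
    _).const_mul _

/-- The three-term recurrence in the degree, with an increment of the order. -/
lemma scaledP_recurrence {z : ℂ} (hz : z - 1 ∈ Complex.slitPlane) (μ : ℂ) (m : ℕ) (ν : ℂ) :
    ((μ + m - ν) ^ 2 - 1 / 4) * scaledP z μ m (ν + 1) =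
      ((μ + m + ν) ^ 2 - 1 / 4) * scaledP z μ m (ν - 1) + 2 * ν * scaledP z μ (m + 1) ν := by
  have h := legendreF_contiguous ν (1 - μ - m) (one_sub_half_mem_slitPlane hz)
  rw [scaledP_eq hz, scaledP_eq hz, scaledP_eq hz]
  have e : 1 - μ - (m : ℂ) - 1 = 1 - μ - (m + 1 : ℕ) := by push_cast; ring
  rw [e] at h
  -- With x = (1 - z)/2 one has 4ν(1 - x) = 2ν(z + 1), which supplies the extra factor z + 1 of the
  -- term of index m + 1.
  linear_combination ((z + 1) / (z - 1)) ^ (μ / 2) * (z + 1) ^ m * h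

/-! ### Gamma normalization and the derivative formulas -/

lemma hasDerivAt_Gamma_mul_Gamma {s ν : ℂ} (h1 : ∀ j : ℕ, s - ν ≠ -j)
    (h2 : ∀ j : ℕ, s + ν ≠ -j) :
    HasDerivAt (fun ν => Complex.Gamma (s - ν) * Complex.Gamma (s + ν))
      (Complex.Gamma (s - ν) * Complex.Gamma (s + ν)
        * (Complex.digamma (s + ν) - Complex.digamma (s - ν))) ν := by
  have g1 := (Complex.differentiableAt_Gamma _ h1).hasDerivAt.comp_const_sub s ν
  have g2 := (Complex.differentiableAt_Gamma _ h2).hasDerivAt.comp_const_add s ν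
  refine (g1.mul g2).congr_deriv ?_
  have n1 := Complex.Gamma_ne_zero h1
  have n2 := Complex.Gamma_ne_zero h2
  rw [Complex.digamma_def, logDeriv_apply, logDeriv_apply]
  field_simp
  ring

lemma ne_neg_natCast_add {s : ℂ} (h : ∀ j : ℕ, s ≠ -j) (k : ℕ) : ∀ j : ℕ, s + k ≠ -j := by
  intro j hj
  refine h (j + k) ?_
  push_cast
  linear_combination hj

/-- Since 1/Γ is entire, the normalized recurrence holds for every μ and ν. -/
lemma hasDerivAt_scaledP_mul_inv_Gamma {z : ℂ} (hz : z - 1 ∈ Complex.slitPlane) (μ : ℂ) (n : ℕ) :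
    HasDerivAt (fun ν => scaledP z μ 0 ν
        * ((Complex.Gamma (μ + 1 / 2 - ν))⁻¹ * (Complex.Gamma (μ + 1 / 2 + ν))⁻¹))
      (∑ k ∈ Finset.range n, degreeWeight n k * (scaledP z μ (n - k) k
        * ((Complex.Gamma (μ + n - 2 * k + 1 / 2))⁻¹ * (Complex.Gamma (μ + n + 1 / 2))⁻¹))) n := by
  have h := hasDerivAt_of_recurrence (N := n) (A := fun m ν => scaledP z μ m ν
    * ((Complex.Gamma (μ + m + 1 / 2 - ν))⁻¹ * (Complex.Gamma (μ + m + 1 / 2 + ν))⁻¹))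
    ?_ ?_ ?_ n 0 le_rfl
  · simp only [Nat.cast_zero, add_zero, zero_add] at h
    refine h.congr_deriv (Finset.sum_congr rfl fun k hk => ?_)
    rw [Nat.cast_sub (Finset.mem_range.1 hk).le,
      show μ + ((n : ℂ) - k) + 1 / 2 - k = μ + n - 2 * k + 1 / 2 by ring,
      show μ + ((n : ℂ) - k) + 1 / 2 + k = μ + n + 1 / 2 by ring]
  · intro m ν
    simp only [scaledP_neg, sub_neg_eq_add, ← sub_eq_add_neg]
    ring
  · intro n m _
    refine (scaledP_differentiable hz μ m _).mul (DifferentiableAt.mul ?_ ?_)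
    · exact Complex.differentiable_one_div_Gamma.differentiableAt.comp _ (by fun_prop)
    · exact Complex.differentiable_one_div_Gamma.differentiableAt.comp _ (by fun_prop)
  · intro n m _
    refine Filter.Eventually.of_forall fun ν => ?_
    have hr := scaledP_recurrence hz μ m ν
    set u := μ + m + 1 / 2 - ν with hu
    set v := μ + m + 1 / 2 + ν with hv
    have u1 : (Complex.Gamma (u - 1))⁻¹ = (u - 1) * (u * (Complex.Gamma (u + 1))⁻¹) := by
      rw [inv_Gamma_eq, sub_add_cancel, inv_Gamma_eq u]
    have v1 : (Complex.Gamma (v - 1))⁻¹ = (v - 1) * (v * (Complex.Gamma (v + 1))⁻¹) := by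
      rw [inv_Gamma_eq, sub_add_cancel, inv_Gamma_eq v]
    simp only [Nat.cast_succ]
    rw [show μ + m + 1 / 2 - (ν + 1) = u - 1 by rw [hu]; ring,
      show μ + m + 1 / 2 + (ν + 1) = v + 1 by rw [hv]; ring,
      show μ + m + 1 / 2 - (ν - 1) = u + 1 by rw [hu]; ring,
      show μ + m + 1 / 2 + (ν - 1) = v - 1 by rw [hv]; ring,
      show μ + (m + 1) + 1 / 2 - ν = u + 1 by rw [hu]; ring,
      show μ + (m + 1) + 1 / 2 + ν = v + 1 by rw [hv]; ring, u1, v1]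
    rw [show (μ + m - ν) ^ 2 - 1 / 4 = (u - 1) * u by rw [hu]; ring,
      show (μ + m + ν) ^ 2 - 1 / 4 = (v - 1) * v by rw [hv]; ring] at hr
    linear_combination (Complex.Gamma (u + 1))⁻¹ * (Complex.Gamma (v + 1))⁻¹ * hr

/-- Here Γ has poles, so the recurrence is available only in the triangle l + m + 1 ≤ n and for ν
near l. There the Gamma arguments at ν = l differ from μ - n + 1/2 by natural numbers, and the
hypothesis excludes poles. -/
lemma hasDerivAt_scaledP_mul_Gamma {z : ℂ} (hz : z - 1 ∈ Complex.slitPlane) {μ : ℂ} {n : ℕ}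
    (hμ : ∀ j : ℕ, μ - n + 1 / 2 ≠ -j) :
    HasDerivAt (fun ν => scaledP z (-μ) 0 ν
        * (Complex.Gamma (μ + 1 / 2 - ν) * Complex.Gamma (μ + 1 / 2 + ν)))
      (∑ k ∈ Finset.range n, degreeWeight n k * (scaledP z (-μ) (n - k) k
        * (Complex.Gamma (μ - n + 1 / 2) * Complex.Gamma (μ - n + 2 * k + 1 / 2)))) n := by
  have h := hasDerivAt_of_recurrence (N := n) (A := fun m ν => scaledP z (-μ) m ν
    * (Complex.Gamma (μ - m + 1 / 2 - ν) * Complex.Gamma (μ - m + 1 / 2 + ν)))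
    ?_ ?_ ?_ n 0 le_rfl
  · simp only [Nat.cast_zero, sub_zero, zero_add] at h
    refine h.congr_deriv (Finset.sum_congr rfl fun k hk => ?_)
    rw [Nat.cast_sub (Finset.mem_range.1 hk).le,
      show μ - ((n : ℂ) - k) + 1 / 2 - k = μ - n + 1 / 2 by ring,
      show μ - ((n : ℂ) - k) + 1 / 2 + k = μ - n + 2 * k + 1 / 2 by ring]
  · intro m ν
    simp only [scaledP_neg, sub_neg_eq_add, ← sub_eq_add_neg]
    ring
  · intro l m hlm
    refine (scaledP_differentiable hz (-μ) m _).mul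
      (hasDerivAt_Gamma_mul_Gamma ?_ ?_).differentiableAt
    · have := ne_neg_natCast_add hμ (n - (l + m))
      rwa [Nat.cast_sub hlm, Nat.cast_add, show μ - (n : ℂ) + 1 / 2 + (n - (l + m))
        = μ - m + 1 / 2 - l by ring] at this
    · have := ne_neg_natCast_add (ne_neg_natCast_add hμ (n - (l + m))) (2 * l)
      rwa [Nat.cast_sub hlm, Nat.cast_add, Nat.cast_mul, Nat.cast_ofNat,
        show μ - (n : ℂ) + 1 / 2 + (n - (l + m)) + 2 * l = μ - m + 1 / 2 + l by ring] at this
  · intro l m hlm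
    have hne (f : ℂ → ℂ) (hf : Continuous f) (k : ℕ) (hk : f l = μ - n + 1 / 2 + k) :
        ∀ᶠ ν in nhds (l : ℂ), f ν ≠ 0 := by
      refine hf.continuousAt.eventually_ne ?_
      rw [hk]
      simpa using ne_neg_natCast_add hμ k 0
    have hcast : ((n - (l + m + 1) : ℕ) : ℂ) = n - (l + m + 1) := by
      rw [Nat.cast_sub hlm]; push_cast; ring
    filter_upwards [hne (fun ν => μ - m + 1 / 2 - ν - 1) (by fun_prop) (n - (l + m + 1))
        (by rw [hcast]; ring),
      hne (fun ν => μ - m + 1 / 2 - ν) (by fun_prop) (n - (l + m + 1) + 1)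
        (by rw [Nat.cast_add, hcast]; push_cast; ring),
      hne (fun ν => μ - m + 1 / 2 + ν - 1) (by fun_prop) (n - (l + m + 1) + 2 * l)
        (by rw [Nat.cast_add, hcast]; push_cast; ring),
      hne (fun ν => μ - m + 1 / 2 + ν) (by fun_prop) (n - (l + m + 1) + 2 * l + 1)
        (by rw [Nat.cast_add, Nat.cast_add, hcast]; push_cast; ring)] with ν n1 n2 n3 n4
    have hr := scaledP_recurrence hz (-μ) m ν
    set u := μ - m + 1 / 2 - ν with hu
    set v := μ - m + 1 / 2 + ν with hv
    have u1 : Complex.Gamma (u + 1) = u * ((u - 1) * Complex.Gamma (u - 1)) := by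
      rw [Complex.Gamma_add_one _ n2, ← Complex.Gamma_add_one _ n1, sub_add_cancel]
    have v1 : Complex.Gamma (v + 1) = v * ((v - 1) * Complex.Gamma (v - 1)) := by
      rw [Complex.Gamma_add_one _ n4, ← Complex.Gamma_add_one _ n3, sub_add_cancel]
    simp only [Nat.cast_succ]
    rw [show μ - m + 1 / 2 - (ν + 1) = u - 1 by rw [hu]; ring,
      show μ - m + 1 / 2 + (ν + 1) = v + 1 by rw [hv]; ring,
      show μ - m + 1 / 2 - (ν - 1) = u + 1 by rw [hu]; ring,
      show μ - m + 1 / 2 + (ν - 1) = v - 1 by rw [hv]; ring,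
      show μ - (m + 1) + 1 / 2 - ν = u - 1 by rw [hu]; ring,
      show μ - (m + 1) + 1 / 2 + ν = v - 1 by rw [hv]; ring, u1, v1]
    rw [show (-μ + m - ν) ^ 2 - 1 / 4 = (v - 1) * v by rw [hv]; ring,
      show (-μ + m + ν) ^ 2 - 1 / 4 = (u - 1) * u by rw [hu]; ring] at hr
    linear_combination Complex.Gamma (u - 1) * Complex.Gamma (v - 1) * hr

lemma degreeWeight_eq {n k : ℕ} (hk : k < n) :
    degreeWeight n k = n.factorial * (k.factorial * ((n : ℂ) - k)
      * (2 : ℂ) ^ ((k : ℤ) - n + 1))⁻¹ := by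
  have hp : (2 : ℂ) ^ ((k : ℤ) - n + 1) = 2 * (2 ^ (n - k))⁻¹ := by
    rw [show (k : ℤ) - n + 1 = 1 + -((n - k : ℕ) : ℤ) by omega, zpow_add₀ two_ne_zero, zpow_one,
      zpow_neg, zpow_natCast]
  rw [degreeWeight, hp, div_eq_mul_inv]
  simp only [mul_inv, inv_inv]
  ring

lemma hasDerivAt_legendreP {z : ℂ} (hz : z - 1 ∈ Complex.slitPlane) {μ : ℂ} {n : ℕ}
    (hμ : ∀ j : ℕ, μ - n + 1 / 2 ≠ -j) :
    HasDerivAt (fun ν => legendreP (ν - 1 / 2) μ z) (degreeDerivP n μ z) n := by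
  have hμ1 : ∀ j : ℕ, μ + 1 / 2 - n ≠ -j := by rwa [add_sub_right_comm]
  have hμ2 : ∀ j : ℕ, μ + 1 / 2 + n ≠ -j := by
    have := ne_neg_natCast_add hμ (2 * n)
    rwa [Nat.cast_mul, Nat.cast_ofNat,
      show μ - (n : ℂ) + 1 / 2 + 2 * n = μ + 1 / 2 + n by ring] at this
  have hG := hasDerivAt_Gamma_mul_Gamma hμ1 hμ2
  have n1 := Complex.Gamma_ne_zero hμ1
  have n2 := Complex.Gamma_ne_zero hμ2
  -- The function is recovered near n as its normalization times ΓΓ; differentiating ΓΓ yields the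
  -- digamma term.
  have h := (hasDerivAt_scaledP_mul_inv_Gamma hz μ n).mul hG
  have hev : (fun ν => legendreP (ν - 1 / 2) μ z) =ᶠ[nhds (n : ℂ)] (fun ν => scaledP z μ 0 ν
        * ((Complex.Gamma (μ + 1 / 2 - ν))⁻¹ * (Complex.Gamma (μ + 1 / 2 + ν))⁻¹))
      * fun ν => Complex.Gamma (μ + 1 / 2 - ν) * Complex.Gamma (μ + 1 / 2 + ν) := by
    filter_upwards [hG.continuousAt.eventually_ne (mul_ne_zero n1 n2)] with ν hν
    rw [Pi.mul_apply, scaledP_zero, ← mul_inv, mul_assoc, inv_mul_cancel₀ hν, mul_one]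
  refine (h.congr_of_eventuallyEq hev).congr_deriv ?_
  have s1 : μ + (n : ℂ) + 1 / 2 = μ + 1 / 2 + n := by ring
  have s2 : μ - (n : ℂ) + 1 / 2 = μ + 1 / 2 - n := by ring
  rw [degreeDerivP, add_comm, scaledP_zero, s1, s2]
  congr 1
  · generalize legendreP _ _ _ = P
    generalize Complex.digamma _ - Complex.digamma _ = D
    generalize Complex.Gamma (μ + 1 / 2 - n) = g1 at n1 ⊢
    generalize Complex.Gamma (μ + 1 / 2 + n) = g2 at n2 ⊢
    field_simp
  · rw [Finset.sum_mul, Finset.mul_sum]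
    refine Finset.sum_congr rfl fun k hk => ?_
    have hk' := Finset.mem_range.1 hk
    rw [degreeWeight_eq hk', scaledP, Nat.cast_sub hk'.le, 
      show μ + ((n : ℂ) - k) = μ + n - k by ring]
    generalize legendreP _ _ _ = P
    generalize sqSubOnePow _ _ = Q
    generalize Complex.Gamma (μ + 1 / 2 - n) = g1 at n1 ⊢
    generalize Complex.Gamma (μ + 1 / 2 + n) = g2 at n2 ⊢
    generalize Complex.Gamma (μ + n - 2 * k + 1 / 2) = g3
    simp only [mul_inv, div_eq_mul_inv]
    linear_combination (n.factorial : ℂ) * ((k.factorial : ℂ)⁻¹ * ((n : ℂ) - k)⁻¹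
      * ((2 : ℂ) ^ ((k : ℤ) - n + 1))⁻¹) * Q * P * g1 * g3⁻¹ * mul_inv_cancel₀ n2

lemma hasDerivAt_legendreP_neg {z : ℂ} (hz : z - 1 ∈ Complex.slitPlane) {μ : ℂ} {n : ℕ}
    (hμ : ∀ j : ℕ, μ - n + 1 / 2 ≠ -j) :
    HasDerivAt (fun ν => legendreP (ν - 1 / 2) (-μ) z) (degreeDerivPNeg n μ z) n := by
  have hμ1 : ∀ j : ℕ, μ + 1 / 2 - n ≠ -j := by rwa [add_sub_right_comm]
  have hμ2 : ∀ j : ℕ, μ + 1 / 2 + n ≠ -j := by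
    have := ne_neg_natCast_add hμ (2 * n)
    rwa [Nat.cast_mul, Nat.cast_ofNat,
      show μ - (n : ℂ) + 1 / 2 + 2 * n = μ + 1 / 2 + n by ring] at this
  have hG := hasDerivAt_Gamma_mul_Gamma hμ1 hμ2
  have n1 := Complex.Gamma_ne_zero hμ1
  have n2 := Complex.Gamma_ne_zero hμ2
  have hT := (scaledP_differentiable hz (-μ) 0 n).hasDerivAt
  -- The derivative of P·ΓΓ computed in two ways; the nonzero value of ΓΓ at n is cancelled below.
  have e := (hasDerivAt_scaledP_mul_Gamma hz hμ).unique (hT.mul hG)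
  have hP : HasDerivAt (fun ν => legendreP (ν - 1 / 2) (-μ) z)
      (deriv (scaledP z (-μ) 0) n) n :=
    hT.congr_of_eventuallyEq (Filter.Eventually.of_forall fun ν => (scaledP_zero z (-μ) ν).symm)
  refine hP.congr_deriv ?_
  have s1 : μ + (n : ℂ) + 1 / 2 = μ + 1 / 2 + n := by ring
  have s2 : μ - (n : ℂ) + 1 / 2 = μ + 1 / 2 - n := by ring
  refine mul_right_cancel₀ (mul_ne_zero n1 n2) ?_
  rw [← sub_eq_iff_eq_add] at e
  rw [← e, degreeDerivPNeg, scaledP_zero, s1, s2, add_mul, sub_eq_neg_add]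
  congr 1
  · ring
  · rw [Finset.mul_sum, Finset.sum_mul]
    refine Finset.sum_congr rfl fun k hk => ?_
    have hk' := Finset.mem_range.1 hk
    rw [degreeWeight_eq hk', scaledP, Nat.cast_sub hk'.le,
      show -μ + ((n : ℂ) - k) = -μ + n - k by ring]
    generalize legendreP _ _ _ = P
    generalize sqSubOnePow _ _ = Q
    generalize Complex.Gamma (μ + 1 / 2 - n) = g1 at n1 ⊢
    generalize Complex.Gamma (μ + 1 / 2 + n) = g2 at n2 ⊢
    generalize Complex.Gamma (μ - n + 2 * k + 1 / 2) = g3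
    simp only [mul_inv, div_eq_mul_inv]
    linear_combination -(n.factorial : ℂ) * ((k.factorial : ℂ)⁻¹ * ((n : ℂ) - k)⁻¹
      * ((2 : ℂ) ^ ((k : ℤ) - n + 1))⁻¹) * Q * P * g1 * g3 * mul_inv_cancel₀ n2

/-- Passing from n to n + 1 adds 1/(μ+n+1/2) + 1/(μ-n-1/2), whose sum is 2μ/(μ² - (n+1/2)²). -/
lemma digamma_sub_digamma (n : ℕ) (μ : ℂ) (hμ : ∀ j : ℕ, μ - n + 1 / 2 ≠ -j) :
    Complex.digamma (μ + n + 1 / 2) - Complex.digamma (μ - n + 1 / 2) =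
      2 * μ * ∑ l ∈ Finset.Icc 1 n, (μ ^ 2 - ((l : ℂ) - 1 / 2) ^ 2)⁻¹ := by
  induction n with
  | zero => simp
  | succ n ih =>
    have hn : ∀ j : ℕ, μ - n + 1 / 2 ≠ -j := by
      have := ne_neg_natCast_add hμ 1
      rwa [Nat.cast_one, Nat.cast_succ,
        show μ - ((n : ℂ) + 1) + 1 / 2 + 1 = μ - n + 1 / 2 by ring] at this
    have hp : ∀ j : ℕ, μ + n + 1 / 2 ≠ -j := by
      have := ne_neg_natCast_add hn (2 * n)
      rwa [Nat.cast_mul, Nat.cast_ofNat,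
        show μ - (n : ℂ) + 1 / 2 + 2 * n = μ + n + 1 / 2 by ring] at this
    have d1 := Complex.digamma_apply_add_one _ hp
    have d2 := Complex.digamma_apply_add_one _ hμ
    have z1 : μ + n + 1 / 2 ≠ 0 := by simpa using hp 0
    have z2 : μ - (n + 1 : ℕ) + 1 / 2 ≠ 0 := by simpa using hμ 0
    rw [Finset.sum_Icc_succ_top (by omega), mul_add, ← ih hn]
    rw [show μ - ((n + 1 : ℕ) : ℂ) + 1 / 2 + 1 = μ - n + 1 / 2 by push_cast; ring] at d2
    rw [show μ + ((n + 1 : ℕ) : ℂ) + 1 / 2 = μ + n + 1 / 2 + 1 by push_cast; ring, d1, d2,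
      show μ ^ 2 - (((n + 1 : ℕ) : ℂ) - 1 / 2) ^ 2
        = (μ + n + 1 / 2) * (μ - (n + 1 : ℕ) + 1 / 2) by push_cast; ring, mul_inv]
    have c1 := mul_inv_cancel₀ z1
    have c2 := mul_inv_cancel₀ z2
    generalize (μ + n + 1 / 2)⁻¹ = i1 at *
    generalize (μ - (n + 1 : ℕ) + 1 / 2)⁻¹ = i2 at *
    push_cast at c1 c2
    linear_combination -i2 * c1 - i1 * c2

lemma legendreP_neg_degree (z μ ν : ℂ) :
    legendreP (-ν - 1 / 2) μ z = legendreP (ν - 1 / 2) μ z := by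
  rw [← scaledP_zero, ← scaledP_zero, scaledP_neg]

lemma exists_hasDerivAt_legendreP_one {z : ℂ} (hz : z - 1 ∈ Complex.slitPlane) (μ : ℂ) :
    ∃ d : ℂ, HasDerivAt (fun ν => legendreP (ν - 1 / 2) μ z) d 1 ∧
      (μ ^ 2 - 1 / 4) * d = 2 * μ * legendreP (1 / 2) μ z
          + sqSubOnePow z (1 / 2) * legendreP (-1 / 2) (μ + 1) z := by
  have h1 := (scaledP_differentiable hz μ 0 1).hasDerivAt
  have h0 := (scaledP_differentiable hz μ 1 0).hasDerivAt
  refine ⟨deriv (scaledP z μ 0) 1, h1.congr_of_eventuallyEq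
    (Filter.Eventually.of_forall fun ν => (scaledP_zero z μ ν).symm), ?_⟩
  have hp : HasDerivAt (fun ν => scaledP z μ 0 (ν + 1)) (deriv (scaledP z μ 0) 1) 0 :=
    HasDerivAt.comp_add_const 0 1 (by rwa [zero_add])
  have hm : HasDerivAt (fun ν => scaledP z μ 0 (ν - 1)) (-deriv (scaledP z μ 0) 1) 0 :=
    HasDerivAt.comp_sub_const 0 1 (by rw [zero_sub]; exact h1.of_even (scaledP_neg z μ 0))
  have hq1 : HasDerivAt (fun ν : ℂ => (μ - ν) ^ 2 - 1 / 4) (-2 * μ) 0 := by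
    refine ((((hasDerivAt_id (0 : ℂ)).const_sub μ).pow 2).sub_const (1 / 4)).congr_deriv ?_
    simp
  have hq2 : HasDerivAt (fun ν : ℂ => (μ + ν) ^ 2 - 1 / 4) (2 * μ) 0 := by
    refine ((((hasDerivAt_id (0 : ℂ)).const_add μ).pow 2).sub_const (1 / 4)).congr_deriv ?_
    simp
  -- Both sides of the unnormalized recurrence with m = 0 are differentiated at ν = 0. Evenness
  -- makes the derivative at -1 the negative of that at 1, so the unknown appears twice and e is
  -- halved.
  have hl := hq1.mul hp
  have hr := (hq2.mul hm).add (((hasDerivAt_id (0 : ℂ)).const_mul 2).mul h0)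
  have e := (hl.congr_of_eventuallyEq (Filter.Eventually.of_forall fun ν => ?_)).unique hr
  · have t1 : scaledP z μ 0 1 = legendreP (1 / 2) μ z := by rw [scaledP_zero]; norm_num
    have t0 : scaledP z μ 1 0 = sqSubOnePow z (1 / 2) * legendreP (-1 / 2) (μ + 1) z := by
      rw [scaledP, Nat.cast_one, zero_sub, neg_div]
    simp only [id, zero_add, zero_sub, scaledP_neg, t1, t0, sub_zero, add_zero] at e
    linear_combination e / 2
  · have := scaledP_recurrence hz μ 0 ν
    simpa using this.symm

theorem mainTheorem2 (z : ℂ) (hz : z - 1 ∈ Complex.slitPlane) :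
    -- the formula at `ν = ± n`, for order `μ`
    (∀ (n : ℕ) (μ : ℂ), (∀ j : ℕ, μ - n + 1 / 2 ≠ -j) →
      HasDerivAt (fun ν => legendreP (ν - 1 / 2) μ z) (degreeDerivP n μ z) n ∧
      HasDerivAt (fun ν => legendreP (ν - 1 / 2) μ z) (-degreeDerivP n μ z) (-n)) ∧
    -- the equivalent form, for order `-μ`
    (∀ (n : ℕ) (μ : ℂ), (∀ j : ℕ, μ - n + 1 / 2 ≠ -j) →
      HasDerivAt (fun ν => legendreP (ν - 1 / 2) (-μ) z) (degreeDerivPNeg n μ z) n ∧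
      HasDerivAt (fun ν => legendreP (ν - 1 / 2) (-μ) z) (-degreeDerivPNeg n μ z) (-n)) ∧
    -- the difference of digamma values as a finite sum
    (∀ (n : ℕ) (μ : ℂ), (∀ j : ℕ, μ - n + 1 / 2 ≠ -j) →
      Complex.digamma (μ + n + 1 / 2) - Complex.digamma (μ - n + 1 / 2) =
        2 * μ * ∑ l ∈ Finset.Icc 1 n, (μ ^ 2 - ((l : ℂ) - 1 / 2) ^ 2)⁻¹) ∧
    -- `ν = 0`
    (∀ μ : ℂ, HasDerivAt (fun ν => legendreP (ν - 1 / 2) μ z) 0 0) ∧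
    -- `ν = ± 1`
    (∀ μ : ℂ, ∃ d : ℂ,
      HasDerivAt (fun ν => legendreP (ν - 1 / 2) μ z) d 1 ∧
      HasDerivAt (fun ν => legendreP (ν - 1 / 2) μ z) (-d) (-1) ∧
      (μ ^ 2 - 1 / 4) * d =
        2 * μ * legendreP (1 / 2) μ z
          + sqSubOnePow z (1 / 2) * legendreP (-1 / 2) (μ + 1) z) := by
  refine ⟨fun n μ hμ => ?_, fun n μ hμ => ?_, digamma_sub_digamma, fun μ => ?_, fun μ => ?_⟩
  · have h := hasDerivAt_legendreP hz hμ
    exact ⟨h, h.of_even (legendreP_neg_degree z μ)⟩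
  · have h := hasDerivAt_legendreP_neg hz hμ
    exact ⟨h, h.of_even (legendreP_neg_degree z (-μ))⟩
  · have h := (scaledP_differentiable hz μ 0 0).hasDerivAt
    rw [h.eq_zero_of_even (scaledP_neg z μ 0)] at h
    exact h.congr_of_eventuallyEq
      (Filter.Eventually.of_forall fun ν => (scaledP_zero z μ ν).symm)
  · obtain ⟨d, hd, e⟩ := exists_hasDerivAt_legendreP_one hz μ
    exact ⟨d, hd, hd.of_even (legendreP_neg_degree z μ), e⟩
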